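/- Let $F$ be a field, $K$ a finite simplicial complex (geometrically realised in a real normed space), $|K|$ its underlying space, and $X$ a topological space. Let $Z\subseteq\mathbb R$ be an interval, bounded or unbounded (for instance $Z=\mathbb R$ or a compact interval). Towers of covers. A tower of covers $\mathfrak W$ of $Z$ with resolution $r=\mathrm{res}(\mathfrak W)$ consists of, for each real $\varepsilon\ge r$, a locally finite indexed cover $\mathcal W_\varepsilon$ of $Z$ by path connected (relatively) open sets, together with, for $r\le\varepsilon\le\varepsilon'$, maps of index sets $w_{\varepsilon,\varepsilon'}$ from $\mathcal W_\varepsilon$ to $\mathcal W_{\varepsilon'}$ sending each member to a member that contains it, with $w_{\varepsilon,\varepsilon}=\mathrm{id}$ and $w_{\varepsilon',\varepsilon''}\circ w_{\varepsilon,\varepsilon'}=w_{\varepsilon,\varepsilon''}$. (If $Z$ is compact, each $\mathcal W_\varepsilon$ is finite.) For $c\ge 1$ and $s>0$, the tower is $(c,s)$-good if $\mathrm{res}(\mathfrak W)=s\le\mathrm{diam}(Z)$; $\mathrm{diam}(W)\le\varepsilon$ for all $\varepsilon\ge s$ and all $W\in\mathcal W_\varepsilon$; and every bounded $O\subseteq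 Z$ with $\mathrm{diam}(O)\ge s$ is contained in some $W\in\mathcal W_{c\cdot\mathrm{diam}(O)}$. The tower $\mathrm R_{\log}(\mathfrak W)$ has resolution $\log s$ and cover $\mathcal W_{e^{\varepsilon}}$ at scale $\varepsilon\ge\log s$. Multiscale mapper. For a continuous map $u:Y\to Z$, the pullback of a tower of covers has at each scale the cover of $Y$ by all path components of the preimages of the members of the cover, a component being sent to the component that contains it; $\mathrm{MM}(\mathfrak W,u)$ is the tower of nerves of these covers. $\mathrm D_k\mathrm{MM}(\mathfrak W,u)$ denotes the persistence diagram of the persistence module obtained by applying $k$-th simplicial homology with coefficients in $F$ (the module being $0$ below its resolution). Diagrams are multisets of points (birth, death) with birth $<$ death $\le\infty$. The bottleneck distance between two diagrams is the infimum, over all partial matchings of the points with finite death together with bijections of the points with infinite death, of the larger of: the supremum of the $\ell^\infty$-distances of matched points (of the births, for points with infinite death), and the supremum of the $\ell^\infty$-distances to the diagonal of unmatched points; it is $\infty$ if there is no such bijection. Statement. Let $f:|K|\to\mathbb R$ be piecewise linear, i.e. given by its values at the vertices of $K$ and interpolated linearly on each simplex. Let $g:X\to\mathbb R$ be continuous.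 Suppose that $f$ and $g$ take values in $Z$ and that $g$, as a map into $Z$, is well-behaved: $g^{-1}(U)$ has finitely many path components for every path connected open $U\subseteq Z$. Suppose that $f$ $\delta$-approximates $g$: there is a homeomorphism $h:X\to|K|$ with $|f(y)-g(h^{-1}(y))|\le\delta$ for all $y\in|K|$. Let $\mathfrak W$ be a $(c,s)$-good tower of covers of $Z$. Then for every $k\in\mathbb N$ the persistence modules $\mathrm H_k(\mathrm{MM}(\mathrm R_{\log}(\mathfrak W),f);F)$ and $\mathrm H_k(\mathrm{MM}(\mathrm R_{\log}(\mathfrak W),g);F)$ are pointwise finite dimensional, and the bottleneck distance between the persistence diagrams $\mathrm D_k\mathrm{MM}(\mathrm R_{\log}(\mathfrak W),f)$ and $\mathrm D_k\mathrm{MM}(\mathrm R_{\log}(\mathfrak W),g)$ is at most $$\log\big(2c\max(s,\delta)+c\big)+\max\Big(0,\log\frac1s\Big).$$ -/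

import Mathlib

open CategoryTheory
open scoped ENNReal

universe u v

noncomputable section

namespace MultiMapper

/-! ### Towers of covers -/

/-- A tower of covers of `X` with resolution `res`: for every `ε ≥ res` an indexed family of sets
covering `X`, together with functorial maps of covers from scale `a` to every scale `b ≥ a`. -/
structure CoverTower (X : Type v) where
  res : ℝ
  ι : Set.Ici res → Type u
  U : ∀ a, ι a → Set X
  iUnion_eq : ∀ a, ⋃ i, U a i = Set.univ
  map : ∀ {a b : Set.Ici res}, a ≤ b → ι a → ι b
  subset_map : ∀ {a b : Set.Ici res} (h : a ≤ b) (i : ι a), U a i ⊆ U b (map h i)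
  map_refl : ∀ (a : Set.Ici res) (i : ι a), map (le_refl a) i = i
  map_trans : ∀ {a b c : Set.Ici res} (h : a ≤ b) (h' : b ≤ c) (i : ι a),
    map h' (map h i) = map (h.trans h') i

/-- The covers are locally finite and consist of path connected open sets. On a compact space,
local finiteness means that every cover has finitely many members. -/
structure CoverTower.IsOpenTower {Z : Type v} [TopologicalSpace Z] (W : CoverTower.{u} Z) : Prop where
  isOpen : ∀ a i, IsOpen (W.U a i)
  isPathConnected : ∀ a i, IsPathConnected (W.U a i)
  locallyFinite : ∀ a, LocallyFinite (W.U a)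

/-- `(c, s)`-good towers of covers of a metric space. Bounded sets are singled out in the last
field because the space is not assumed to be bounded; there `a` is the scale `c * diam O`, which is
`≥ s` since `c ≥ 1`. -/
structure CoverTower.IsGood {Z : Type v} [MetricSpace Z] (W : CoverTower.{u} Z) (c s : ℝ) : Prop where
  one_le : 1 ≤ c
  pos : 0 < s
  res_eq : W.res = s
  le_diam : ENNReal.ofReal s ≤ Metric.ediam (Set.univ : Set Z)
  diam_le : ∀ (a : Set.Ici W.res) (i : W.ι a), Metric.ediam (W.U a i) ≤ ENNReal.ofReal (a : ℝ)
  exists_superset : ∀ O : Set Z, Bornology.IsBounded O → s ≤ Metric.diam O →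
    ∀ a : Set.Ici W.res, (a : ℝ) = c * Metric.diam O → ∃ i : W.ι a, O ⊆ W.U a i

theorem CoverTower.IsGood.res_pos {Z : Type v} [MetricSpace Z] {W : CoverTower.{u} Z} {c s : ℝ}
    (h : W.IsGood c s) : 0 < W.res := h.res_eq ▸ h.pos

/-- Reindexing along a monotone map of parameters `ψ`. -/
def CoverTower.reindex {X : Type v} (W : CoverTower.{u} X) {r : ℝ}
    (ψ : Set.Ici r →o Set.Ici W.res) : CoverTower.{u} X where
  res := r
  ι a := W.ι (ψ a)
  U a := W.U (ψ a)
  iUnion_eq a := W.iUnion_eq (ψ a)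
  map h := W.map (ψ.monotone h)
  subset_map h := W.subset_map (ψ.monotone h)
  map_refl a := W.map_refl (ψ a)
  map_trans h h' := W.map_trans (ψ.monotone h) (ψ.monotone h')

/-- The exponential `[log r, ∞) → [r, ∞)`, inverse to the logarithm. -/
def expIci {r : ℝ} (hr : 0 < r) : Set.Ici (Real.log r) →o Set.Ici r where
  toFun a := ⟨Real.exp a, (Real.log_le_iff_le_exp hr).1 a.2⟩
  monotone' _ _ h := Subtype.mk_le_mk.2 (Real.exp_le_exp.2 h)

/-- The tower `R_log W`: its resolution is `log (res W)` and its cover at scale `ε` is the cover of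
`W` at scale `exp ε`. -/
def CoverTower.reindexLog {X : Type v} (W : CoverTower.{u} X) (h : 0 < W.res) :
    CoverTower.{u} X :=
  W.reindex (expIci h)

/-! ### Pullbacks -/

/-- The map on path components induced by an inclusion of sets. -/
def componentMap {X : Type u} [TopologicalSpace X] {A B : Set X} (h : A ⊆ B) :
    ZerothHomotopy A → ZerothHomotopy B :=
  Quotient.map (Set.inclusion h) fun _ _ ⟨p⟩ => ⟨p.map (continuous_inclusion h)⟩

/-- A path component of `A`, as a subset of the ambient space. -/
def componentSet {X : Type u} [TopologicalSpace X] {A : Set X} (c : ZerothHomotopy A) : Set X :=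
  {x | ∃ h : x ∈ A, (Quotient.mk _ ⟨x, h⟩ : ZerothHomotopy A) = c}

/-- The pullback tower: the cover at each scale consists of all path components of the preimages
of the members of the given cover, and each component is mapped to the component containing it. -/
def CoverTower.pullback {X : Type u} {Z : Type v} [TopologicalSpace X] (W : CoverTower.{u} Z)
    (f : X → Z) : CoverTower.{u} X where
  res := W.res
  ι a := Σ i : W.ι a, ZerothHomotopy (f ⁻¹' W.U a i)
  U a i := componentSet i.2
  iUnion_eq a := by
    refine Set.eq_univ_of_forall fun x => ?_
    have hx : f x ∈ ⋃ i, W.U a i := by rw [W.iUnion_eq a]; trivial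
    obtain ⟨i, hi⟩ := Set.mem_iUnion.1 hx
    exact Set.mem_iUnion.2 ⟨⟨i, Quotient.mk _ ⟨x, hi⟩⟩, hi, rfl⟩
  map h i := ⟨W.map h i.1, componentMap (Set.preimage_mono (W.subset_map h i.1)) i.2⟩
  subset_map := by
    rintro a b h ⟨i, c⟩ x ⟨hx, hc⟩
    refine ⟨W.subset_map h i hx, ?_⟩
    dsimp only at hc ⊢
    rw [← hc]
    rfl
  map_refl := by
    rintro a ⟨i, c⟩
    induction c using Quotient.inductionOn with
    | h x =>
      have key : ∀ (j : W.ι a) (hj : j = i) (hx : x.1 ∈ f ⁻¹' W.U a j),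
          (⟨j, Quotient.mk _ ⟨x.1, hx⟩⟩ : Σ i : W.ι a, ZerothHomotopy (f ⁻¹' W.U a i)) =
            ⟨i, Quotient.mk _ x⟩ := by
        rintro j rfl hx
        rfl
      exact key _ (W.map_refl a i) _
  map_trans := by
    rintro a b c h h' ⟨i, q⟩
    induction q using Quotient.inductionOn with
    | h x =>
      have key : ∀ (j j' : W.ι c) (hj : j = j') (hx : x.1 ∈ f ⁻¹' W.U c j)
          (hx' : x.1 ∈ f ⁻¹' W.U c j'),
          (⟨j, Quotient.mk _ ⟨x.1, hx⟩⟩ : Σ i : W.ι c, ZerothHomotopy (f ⁻¹' W.U c i)) =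
            ⟨j', Quotient.mk _ ⟨x.1, hx'⟩⟩ := by
        rintro j _ rfl hx hx'
        rfl
      exact key _ _ (W.map_trans h h' i) _ _

/-- A map is well-behaved if preimages of path connected open sets have only finitely many path
components. -/
def WellBehaved {X : Type u} {Z : Type v} [TopologicalSpace X] [TopologicalSpace Z] (f : X → Z) : Prop :=
  ∀ V : Set Z, IsOpen V → IsPathConnected V → Finite (ZerothHomotopy (f ⁻¹' V))

/-! ### Nerves and the multiscale mapper -/

/-- A tower of simplicial complexes and simplicial maps. -/
structure SimplicialTower where
  res : ℝ
  V : Set.Ici res → Type u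
  K : ∀ a, PreAbstractSimplicialComplex (V a)
  map : ∀ {a b : Set.Ici res}, a ≤ b → V a → V b
  map_mem : ∀ {a b : Set.Ici res} (h : a ≤ b) (σ : Finset (V a)) (τ : Finset (V b)),
    σ ∈ (K a).faces → (τ : Set (V b)) = map h '' σ → τ ∈ (K b).faces
  map_refl : ∀ (a : Set.Ici res) (v : V a), map (le_refl a) v = v
  map_trans : ∀ {a b c : Set.Ici res} (h : a ≤ b) (h' : b ≤ c) (v : V a),
    map h' (map h v) = map (h.trans h') v

/-- The nerve of a family of sets: a nonempty finite set of indices is a simplex if and only if the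
corresponding sets have a common point. -/
def nerve {X : Type v} {ι : Type u} (U : ι → Set X) : PreAbstractSimplicialComplex ι where
  faces := {σ | σ.Nonempty ∧ (⋂ i ∈ σ, U i).Nonempty}
  isRelLowerSet_faces := fun _ hσ => ⟨hσ.1, fun _ hτ hne =>
    ⟨hne, hσ.2.mono (Set.biInter_mono hτ fun _ _ => subset_rfl)⟩⟩

/-- The nerve of a tower of covers. -/
def CoverTower.nerve {X : Type v} (W : CoverTower.{u} X) : SimplicialTower.{u} where
  res := W.res
  V := W.ι
  K a := MultiMapper.nerve (W.U a)
  map h := W.map h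
  map_mem := by
    rintro a b h σ τ ⟨⟨i, hi⟩, x, hx⟩ hτ
    simp only [Set.mem_iInter] at hx
    have hmem : ∀ j, j ∈ τ ↔ ∃ i ∈ σ, W.map h i = j := fun j => by
      rw [← Finset.mem_coe, hτ]; simp
    refine ⟨⟨_, (hmem _).2 ⟨i, hi, rfl⟩⟩, x, ?_⟩
    simp only [Set.mem_iInter]
    intro j hj
    obtain ⟨i, hi, rfl⟩ := (hmem j).1 hj
    exact W.subset_map h i (hx i hi)
  map_refl := W.map_refl
  map_trans := W.map_trans

/-- The multiscale mapper `MM(W, f)`. -/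
def MM {X : Type u} {Z : Type v} [TopologicalSpace X] (W : CoverTower.{u} Z) (f : X → Z) :
    SimplicialTower.{u} :=
  (W.pullback f).nerve

/-! ### Simplicial homology -/

/-- The simplicial set of ordered simplices of a simplicial complex: its `n`-simplices are the
tuples `(v₀, …, vₙ)` (repetitions allowed) whose entries span a simplex. Its chain complex is the
ordered chain complex of the simplicial complex, which computes simplicial homology. -/
def orderedSSet {V : Type u} (K : PreAbstractSimplicialComplex V) : SSet.{u} where
  obj n := {t : Fin (n.unop.len + 1) → V // ∃ σ ∈ K.faces, (σ : Set V) = Set.range t}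
  map φ := ↾fun t => ⟨t.1 ∘ φ.unop.toOrderHom, by
    classical
    obtain ⟨σ, hσ, hr⟩ := t.2
    refine ⟨Finset.univ.image (t.1 ∘ φ.unop.toOrderHom),
      (K.isRelLowerSet_faces hσ).2 ?_ ⟨_, Finset.mem_image_of_mem _ (Finset.mem_univ 0)⟩,
      by rw [Finset.coe_image, Finset.coe_univ, Set.image_univ]⟩
    intro v hv
    obtain ⟨i, -, rfl⟩ := Finset.mem_image.1 hv
    rw [← Finset.mem_coe, hr]
    exact ⟨_, rfl⟩⟩

/-- A tower of simplicial complexes as a functor to simplicial sets. -/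
def SimplicialTower.toSSet (S : SimplicialTower.{u}) : Set.Ici S.res ⥤ SSet.{u} where
  obj a := orderedSSet (S.K a)
  map {a b} h :=
    { app := fun _ => ↾fun t => ⟨S.map (leOfHom h) ∘ t.1, by
        classical
        obtain ⟨σ, hσ, hr⟩ := t.2
        refine ⟨σ.image (S.map (leOfHom h)), S.map_mem (leOfHom h) σ _ hσ (by simp), ?_⟩
        rw [Finset.coe_image, hr, Set.range_comp]⟩
      naturality := fun _ _ _ => rfl }
  map_id a := by
    ext n t
    exact Subtype.ext (funext fun i => S.map_refl a _)
  map_comp h h' := by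
    ext n t
    exact Subtype.ext (funext fun i => (S.map_trans (leOfHom h) (leOfHom h') _).symm)

/-- The persistence module `H_k(S; F)` of a tower of simplicial complexes. -/
def SimplicialTower.homology (F : Type u) [Field F] (k : ℕ) (S : SimplicialTower.{u}) :
    Set.Ici S.res ⥤ ModuleCat.{u} F :=
  S.toSSet ⋙ (SSet.chainComplexFunctor (ModuleCat.{u} F)).obj (ModuleCat.of F F) ⋙
    HomologicalComplex.homologyFunctor (ModuleCat.{u} F) (ComplexShape.down ℕ) k

/-- The persistence module `H_k(MM(R_log W, f); F)`. -/
def mapperHomology (F : Type u) [Field F] (k : ℕ) {X : Type u} {Z : Type v} [TopologicalSpace X]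
    (W : CoverTower.{u} Z) (hW : 0 < W.res) (f : X → Z) :
    Set.Ici (Real.log W.res) ⥤ ModuleCat.{u} F :=
  (MM (W.reindexLog hW) f).homology F k

/-! ### Persistence diagrams and the bottleneck distance -/

section Persistence

variable {F : Type u} [Field F] {r : ℝ}

/-- All the vector spaces of the persistence module have finite dimension. -/
def PointwiseFinite (M : Set.Ici r ⥤ ModuleCat.{u} F) : Prop :=
  ∀ a, Module.Finite F (M.obj a)

open Classical in
/-- The rank of the structure map from `a` to `b`, the module being extended by zero to the left of
its resolution. -/
def persistentRank (M : Set.Ici r ⥤ ModuleCat.{u} F) (a b : ℝ) : ℕ :=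
  if h : r ≤ a ∧ a ≤ b then
    Module.finrank F (LinearMap.range
      (M.map (homOfLE (show (⟨a, h.1⟩ : Set.Ici r) ≤ ⟨b, h.1.trans h.2⟩ from h.2))).hom)
  else 0

/-- Number of classes born between `a` and `b` (present at `b` but not at `a`) that die between
`c` and `d`, for `a < b ≤ c < d`. -/
def boxCount (M : Set.Ici r ⥤ ModuleCat.{u} F) (a b c d : ℝ) : ℕ :=
  (persistentRank M b c + persistentRank M a d) - (persistentRank M a c + persistentRank M b d)

/-- Number of classes born between `a` and `b` that are still alive at `c`, for `a < b ≤ c`. -/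
def stripCount (M : Set.Ici r ⥤ ModuleCat.{u} F) (a b c : ℝ) : ℕ :=
  persistentRank M b c - persistentRank M a c

/-- A persistence diagram: a multiset of points (birth, death) with finite death, and a multiset of
births of the points whose death is infinite, both given by their multiplicity functions. -/
structure Diagram where
  finite : ℝ × ℝ → ℕ
  essential : ℝ → ℕ

open Classical in
/-- The persistence diagram of a pointwise finite dimensional persistence module. The multiplicity
of an off-diagonal point is the number of classes in all sufficiently small boxes around it. -/
def diagram (M : Set.Ici r ⥤ ModuleCat.{u} F) : Diagram where
  finite p :=
    if p.1 < p.2 then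
      sInf {m | ∃ ε : ℝ, 0 < ε ∧ p.1 + ε ≤ p.2 - ε ∧
        m = boxCount M (p.1 - ε) (p.1 + ε) (p.2 - ε) (p.2 + ε)}
    else 0
  essential b :=
    sInf {m | ∃ ε t : ℝ, 0 < ε ∧ b + ε ≤ t ∧ m = stripCount M (b - ε) (b + ε) t}

/-- The points of a multiset, repeated according to multiplicity. -/
abbrev Points {α : Type} (m : α → ℕ) : Type := Σ x : α, Fin (m x)

/-- Distance of a point to the diagonal in the `ℓ^∞` metric. -/
def diagDist (p : ℝ × ℝ) : ℝ≥0∞ := ENNReal.ofReal ((p.2 - p.1) / 2)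

/-- The cost of a partial matching of the points with finite death: matched points pay their
`ℓ^∞` distance, unmatched points are matched with the diagonal. -/
def matchingCost {m n : ℝ × ℝ → ℕ} (μ : Points m ≃. Points n) : ℝ≥0∞ :=
  max (⨆ (x) (y) (_ : y ∈ μ x), edist x.1 y.1)
    (max (⨆ (x) (_ : μ x = none), diagDist x.1) (⨆ (y) (_ : μ.symm y = none), diagDist y.1))

/-- The bottleneck distance. Points with infinite death can only be matched with each other. -/
def bottleneckDist (D D' : Diagram) : ℝ≥0∞ :=
  ⨅ (μ : Points D.finite ≃. Points D'.finite) (e : Points D.essential ≃ Points D'.essential),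
    max (matchingCost μ) (⨆ x, edist x.1 (e x).1)

end Persistence

/-! ### Piecewise-linear functions -/

section PL

variable {E : Type u} [NormedAddCommGroup E] [NormedSpace ℝ E]

/-- `f : |K| → ℝ` is piecewise linear on `K`: it is given by values `φ` at the vertices and
interpolates them linearly in each simplex. -/
def IsPL (K : Geometry.SimplicialComplex ℝ E) (f : K.space → ℝ) : Prop :=
  ∃ φ : E → ℝ, ∀ σ ∈ K.faces, ∀ w : E → ℝ, (∀ v ∈ σ, 0 ≤ w v) → ∑ v ∈ σ, w v = 1 →
    ∀ y : K.space, (y : E) = ∑ v ∈ σ, w v • v → f y = ∑ v ∈ σ, w v * φ v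

/-- `f : |K| → ℝ` `δ`-approximates `g : X → ℝ` if `|f - g ∘ h⁻¹| ≤ δ` on `|K|` for some
homeomorphism `h : X → |K|`. -/
def DeltaApproximates {X : Type u} [TopologicalSpace X] (K : Geometry.SimplicialComplex ℝ E)
    (f : K.space → ℝ) (g : X → ℝ) (δ : ℝ) : Prop :=
  ∃ h : X ≃ₜ K.space, ∀ y : K.space, |f y - g (h.symm y)| ≤ δ

end PL

end MultiMapper

end

/-!
Let `|f - g ∘ h⁻¹| ≤ δ`. Thickened by `max s δ`, a member of the tower at scale `a` has diameter at
most `a + 2 max s δ`, hence lies in a member at scale `c (a + 2 max s δ)`. So, up to this change of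
scale, the two pulled back towers refine each other, and in the logarithmic parametrisation the
change of scale is bounded by the shift `η = log (2 c max s δ + c) + max 0 (log (1 / s))`.

Any two maps of nerves induced by a refinement are contiguous, so the homology of nerves is a
functor on families of sets preordered by refinement. Two towers that refine each other up to the
shift `η` are one monotone map from two copies of a half-line, where crossing between the copies
costs `η`, and the ranks of the resulting functor satisfy the box inequalities.

These inequalities alone give a matching of the diagrams. For a fixed death `d`, the number of
classes born up to `x` that die at `d` is monotone in `x`, and its jumps are the points of the
diagram with death `d`; the `i`-th point at a jump from `n` to `n'` is given the level `n + i`. The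
image of the shift by `η` from one module to the other has the births of the first module and the
deaths of the second one, up to the shift. Matching each diagram with that of the image by levels
moves one coordinate of a point by at most `2 η`, and centring the image makes the total cost `η`.
-/

noncomputable section

namespace MultiMapper

open Filter Topology Function
open scoped NNReal

/-! ### Jumps of monotone functions -/

section Jump

variable {α : Type*} [ConditionallyCompleteLinearOrder α] [TopologicalSpace α] [OrderTopology α]
  [DenselyOrdered α] [NoMinOrder α] [NoMaxOrder α] {φ : α → ℕ} {S : Set α} {x y : α}

theorem eventually_eq_leftLim (hφ : MonotoneOn φ S) (hS : S ∈ 𝓝 x) :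
    ∀ᶠ y in 𝓝[<] x, φ y = leftLim φ x := by
  obtain ⟨l, u, hx, hlu⟩ := mem_nhds_iff_exists_Ioo_subset.1 hS
  have hmono : MonotoneOn φ (Set.Ioo l x) := hφ.mono fun y hy => hlu ⟨hy.1, hy.2.trans hx.2⟩
  have hbdd : BddAbove (φ '' Set.Ioo l x) := ⟨φ x, by
    rintro _ ⟨y, hy, rfl⟩
    exact hφ (hlu ⟨hy.1, hy.2.trans hx.2⟩) (hlu hx) hy.2.le⟩
  have hlim := hmono.tendsto_nhdsWithin_Ioo_left (Set.nonempty_Ioo.2 hx.1) hbdd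
  rw [← leftLim_eq_of_tendsto hlim, nhds_discrete] at hlim
  exact tendsto_pure.1 hlim

theorem eventually_eq_rightLim (hφ : MonotoneOn φ S) (hS : S ∈ 𝓝 x) :
    ∀ᶠ y in 𝓝[>] x, φ y = rightLim φ x := by
  obtain ⟨l, u, hx, hlu⟩ := mem_nhds_iff_exists_Ioo_subset.1 hS
  have hmono : MonotoneOn φ (Set.Ioo x u) := hφ.mono fun y hy => hlu ⟨hx.1.trans hy.1, hy.2⟩
  have hlim := hmono.tendsto_nhdsWithin_Ioo_right (Set.nonempty_Ioo.2 hx.2) (OrderBot.bddBelow _)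
  rw [← rightLim_eq_of_tendsto hlim, nhds_discrete] at hlim
  exact tendsto_pure.1 hlim

theorem le_leftLim_of_lt (hφ : MonotoneOn φ S) (hS : S ∈ 𝓝 x) (hy : y ∈ S) (hyx : y < x) :
    φ y ≤ leftLim φ x := by
  obtain ⟨z, ⟨hz, hzS⟩, hyz⟩ := ((eventually_eq_leftLim hφ hS).and
    (mem_nhdsWithin_of_mem_nhds hS)).and (Ioo_mem_nhdsLT hyx) |>.exists
  exact hz ▸ hφ hy hzS hyz.1.le

theorem rightLim_le_of_lt (hφ : MonotoneOn φ S) (hS : S ∈ 𝓝 x) (hy : y ∈ S) (hxy : x < y) :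
    rightLim φ x ≤ φ y := by
  obtain ⟨z, ⟨hz, hzS⟩, hzy⟩ := ((eventually_eq_rightLim hφ hS).and
    (mem_nhdsWithin_of_mem_nhds hS)).and (Ioo_mem_nhdsGT hxy) |>.exists
  exact hz ▸ hφ hzS hy hzy.2.le

theorem exists_leftLim_le_lt_rightLim (hφ : MonotoneOn φ S) (hS : IsOpen S)
    (hS' : S.OrdConnected) {n : ℕ} {x₁ x₂ : α} (hx₁ : x₁ ∈ S) (hx₂ : x₂ ∈ S) (h₁ : φ x₁ ≤ n)
    (h₂ : n < φ x₂) : ∃ x ∈ S, leftLim φ x ≤ n ∧ n < rightLim φ x := by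
  set T := {y ∈ S | φ y ≤ n}
  have hub : x₂ ∈ upperBounds T := fun y ⟨hy, hyn⟩ =>
    not_lt.1 fun hlt => (h₂.trans_le (hφ hx₂ hy hlt.le)).not_ge hyn
  have hT : T.Nonempty := ⟨x₁, hx₁, h₁⟩
  have hx : sSup T ∈ S := hS'.out hx₁ hx₂ ⟨le_csSup ⟨x₂, hub⟩ ⟨hx₁, h₁⟩, csSup_le hT hub⟩
  have hxS := hS.mem_nhds hx
  refine ⟨sSup T, hx, ?_, ?_⟩
  · obtain ⟨y, ⟨hy, hyS⟩, hyx⟩ := ((eventually_eq_leftLim hφ hxS).and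
      (mem_nhdsWithin_of_mem_nhds hxS)).and self_mem_nhdsWithin |>.exists
    obtain ⟨z, ⟨hzS, hz⟩, hyz⟩ := exists_lt_of_lt_csSup hT hyx
    exact hy ▸ (hφ hyS hzS hyz.le).trans hz
  · obtain ⟨y, ⟨hy, hyS⟩, hxy⟩ := ((eventually_eq_rightLim hφ hxS).and
      (mem_nhdsWithin_of_mem_nhds hxS)).and self_mem_nhdsWithin |>.exists
    exact hy ▸ not_le.1 fun hle => (le_csSup ⟨x₂, hub⟩ ⟨hyS, hle⟩).not_gt hxy

end Jump

/-- The height of the jump of `φ` at `x`. -/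
def jump (φ : ℝ → ℕ) (x : ℝ) : ℕ := rightLim φ x - leftLim φ x

/-- `m` counts the jumps of the monotone functions `φ a : S a → ℕ`: under the bijection `E`, the
elements of `β` are the pairs of an index `a` and a position, and the multiplicity of such a pair
is the height of the jump of `φ a` at that position. -/
structure IsJumpCount {A β : Type} (E : β ≃ A × ℝ) (S : A → Set ℝ) (φ : A → ℝ → ℕ)
    (m : β → ℕ) : Prop where
  isOpen : ∀ a, IsOpen (S a)
  isLowerSet : ∀ a, IsLowerSet (S a)
  monotoneOn : ∀ a, MonotoneOn (φ a) (S a)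
  eq_jump : ∀ q, (E q).2 ∈ S (E q).1 → m q = jump (φ (E q).1) (E q).2
  eq_zero : ∀ q, (E q).2 ∉ S (E q).1 → m q = 0

namespace IsJumpCount

variable {A β β' : Type} {E : β ≃ A × ℝ} {S : A → Set ℝ} {φ : A → ℝ → ℕ} {m : β → ℕ}

theorem comap {m' : β' → ℕ} (h : IsJumpCount E S φ m) (σ : β' ≃ β) (hm : ∀ q, m (σ q) = m' q) :
    IsJumpCount (σ.trans E) S φ m' where
  isOpen := h.isOpen
  isLowerSet := h.isLowerSet
  monotoneOn := h.monotoneOn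
  eq_jump q hq := (hm q).symm.trans (h.eq_jump (σ q) hq)
  eq_zero q hq := (hm q).symm.trans (h.eq_zero (σ q) hq)

/-- The `i`-th point at a jump of `φ a` from `n` to `n'` has level `n + i`; over a fixed index,
different points have different levels. -/
def level (E : β ≃ A × ℝ) (φ : A → ℝ → ℕ) (p : Points m) : ℕ :=
  leftLim (φ (E p.1).1) (E p.1).2 + p.2

theorem pos_mem (h : IsJumpCount E S φ m) (p : Points m) : (E p.1).2 ∈ S (E p.1).1 := by
  by_contra hp
  exact (h.eq_zero p.1 hp ▸ p.2).elim0

theorem le_level (h : IsJumpCount E S φ m) (p : Points m) {x : ℝ} (hx : x < (E p.1).2) :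
    φ (E p.1).1 x ≤ level E φ p :=
  (le_leftLim_of_lt (h.monotoneOn _) ((h.isOpen _).mem_nhds (h.pos_mem p))
    (h.isLowerSet _ hx.le (h.pos_mem p)) hx).trans (Nat.le_add_right _ _)

theorem level_lt (h : IsJumpCount E S φ m) (p : Points m) {x : ℝ} (hxS : x ∈ S (E p.1).1)
    (hx : (E p.1).2 < x) : level E φ p < φ (E p.1).1 x := by
  refine lt_of_lt_of_le ?_ (rightLim_le_of_lt (h.monotoneOn _)
    ((h.isOpen _).mem_nhds (h.pos_mem p)) hxS hx)
  have hi := p.2.2.trans_eq (h.eq_jump p.1 (h.pos_mem p))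
  simp only [jump] at hi
  simp only [level]
  omega

theorem pos_le_add_of_level_eq {E' : β' ≃ A × ℝ} {φ' : A → ℝ → ℕ} {m' : β' → ℕ} {K : ℝ}
    (h : IsJumpCount E S φ m) (h' : IsJumpCount E' S φ' m') (hK : 0 ≤ K)
    (hφ : ∀ a, ∀ x ∈ S a, φ' a (x - K) ≤ φ a x) {p : Points m} {q : Points m'}
    (hidx : (E p.1).1 = (E' q.1).1) (hl : level E φ p = level E' φ' q) :
    (E p.1).2 ≤ (E' q.1).2 + K := by
  by_contra! hlt
  obtain ⟨x, hqx, hxp⟩ := exists_between hlt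
  have hx := h.isLowerSet _ hxp.le (h.pos_mem p)
  have hp := h.le_level p hxp
  have hq := h'.level_lt q (hidx ▸ h.isLowerSet _ (sub_le_self x hK) hx) (lt_sub_iff_add_lt.2 hqx)
  have hxφ := hφ _ x hx
  rw [← hidx] at hq
  omega

theorem eq_of_level_eq (h : IsJumpCount E S φ m) {p q : Points m}
    (hidx : (E p.1).1 = (E q.1).1) (hl : level E φ p = level E φ q) : p = q := by
  have hle {p q : Points m} (hidx : (E p.1).1 = (E q.1).1) (hl : level E φ p = level E φ q) :
      (E p.1).2 ≤ (E q.1).2 := by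
    simpa using h.pos_le_add_of_level_eq h le_rfl (by simp) hidx hl
  have hpq : p.1 = q.1 := E.injective (Prod.ext hidx
    (le_antisymm (hle hidx hl) (hle hidx.symm hl.symm)))
  obtain ⟨x, i⟩ := p
  obtain ⟨y, j⟩ := q
  obtain rfl : x = y := hpq
  exact congrArg _ (Fin.ext (Nat.add_left_cancel hl))

theorem exists_level_eq (h : IsJumpCount E S φ m) {a : A} {n : ℕ} {x₁ x₂ : ℝ} (hx₂ : x₂ ∈ S a)
    (h₁ : φ a x₁ ≤ n) (h₂ : n < φ a x₂) (hx : x₁ ≤ x₂) :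
    ∃ p : Points m, (E p.1).1 = a ∧ level E φ p = n := by
  obtain ⟨x, hx, hl, hr⟩ := exists_leftLim_le_lt_rightLim (h.monotoneOn a) (h.isOpen a)
    (h.isLowerSet a).ordConnected (h.isLowerSet a hx hx₂) hx₂ h₁ h₂
  obtain ⟨q, hq⟩ := E.surjective (a, x)
  obtain ⟨rfl, rfl⟩ : (E q).1 = a ∧ (E q).2 = x := by simp only [hq, and_self]
  have hi : n - leftLim (φ (E q).1) (E q).2 < m q := by
    rw [h.eq_jump q hx, jump]
    omega
  exact ⟨⟨q, _, hi⟩, rfl, Nat.add_sub_cancel' hl⟩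

section Matching

variable {E' : β' ≃ A × ℝ} {φ' : A → ℝ → ℕ} {m' : β' → ℕ} {K : ℝ} (h : IsJumpCount E S φ m)
  (h' : IsJumpCount E' S φ' m') (hK : 0 ≤ K) (hle : ∀ a, ∀ x ∈ S a, φ a x ≤ φ' a x)
  (hge : ∀ a, ∀ x ∈ S a, φ' a (x - K) ≤ φ a x)

include h h' hK hle hge

theorem exists_right_level_eq (p : Points m) :
    ∃ q : Points m', (E' q.1).1 = (E p.1).1 ∧ level E' φ' q = level E φ p := by
  have hp := h.pos_mem p
  obtain ⟨x₁, hx₁⟩ := exists_lt (E p.1).2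
  obtain ⟨x₂, hx₂, hx₂S⟩ := nonempty_of_mem (inter_mem
    (self_mem_nhdsWithin (s := Set.Ioi (E p.1).2))
    (mem_nhdsWithin_of_mem_nhds ((h.isOpen _).mem_nhds hp)))
  exact h'.exists_level_eq hx₂S ((hge _ x₁ (h.isLowerSet _ hx₁.le hp)).trans (h.le_level p hx₁))
    ((h.level_lt p hx₂S hx₂).trans_le (hle _ x₂ hx₂S))
    ((sub_le_self x₁ hK).trans (hx₁.trans hx₂).le)

theorem exists_left_level_eq {q : Points m'} {x : ℝ} (hx : x ∈ S (E' q.1).1)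
    (hqx : (E' q.1).2 + K < x) :
    ∃ p : Points m, (E p.1).1 = (E' q.1).1 ∧ level E φ p = level E' φ' q := by
  obtain ⟨x₁, hx₁⟩ := exists_lt (E' q.1).2
  have hqx' := lt_sub_iff_add_lt.2 hqx
  have hxK : x - K ∈ S (E' q.1).1 := h.isLowerSet _ (sub_le_self x hK) hx
  exact h.exists_level_eq hx
    ((hle _ x₁ (h.isLowerSet _ hx₁.le (h'.pos_mem q))).trans (h'.le_level q hx₁))
    ((h'.level_lt q hxK hqx').trans_le (hge _ x hx)) (by linarith)

/-- A point is matched with the point of the same index and the same level. -/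
theorem exists_matching :
    ∃ e : Points m → Points m', Function.Injective e ∧
      (∀ p, (E' (e p).1).1 = (E p.1).1 ∧ (E' (e p).1).2 ≤ (E p.1).2 ∧
        (E p.1).2 ≤ (E' (e p).1).2 + K) ∧
      ∀ q, q ∉ Set.range e → ∀ x ∈ S (E' q.1).1, x ≤ (E' q.1).2 + K := by
  choose e hidx hl using h.exists_right_level_eq h' hK hle hge
  refine ⟨e, fun p q hpq => ?_, fun p => ⟨hidx p, ?_, ?_⟩, fun q hq x hx => ?_⟩
  · exact h.eq_of_level_eq (by rw [← hidx, ← hidx, hpq]) (by rw [← hl, ← hl, hpq])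
  · simpa using h'.pos_le_add_of_level_eq h le_rfl (by simpa using hle) (hidx p) (hl p)
  · exact h.pos_le_add_of_level_eq h' hK hge (hidx p).symm (hl p).symm
  · by_contra! hqx
    obtain ⟨p, hp, hpl⟩ := h.exists_left_level_eq h' hK hle hge hx hqx
    exact hq ⟨p, h'.eq_of_level_eq ((hidx p).trans hp) ((hl p).trans hpl)⟩

end Matching

end IsJumpCount

/-! ### Rank functions -/

/-- The properties of `(p, q) ↦ rank (M p → M q)` for a functor `M` from a preorder to
finite-dimensional vector spaces, as far as they are used for persistence diagrams. -/
structure IsRankFunction {Q : Type*} [Preorder Q] (R : Q → Q → ℕ) : Prop where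
  mono : ∀ {p p' q}, p ≤ p' → p' ≤ q → R p q ≤ R p' q
  anti : ∀ {p q q'}, p ≤ q → q ≤ q' → R p q' ≤ R p q
  box : ∀ {p p' q q'}, p ≤ p' → p' ≤ q → q ≤ q' → R p' q' + R p q ≤ R p q' + R p' q

theorem IsRankFunction.le_of_le_of_le {Q : Type*} [Preorder Q] {R : Q → Q → ℕ}
    (hR : IsRankFunction R) {p p' q q' : Q} (h : p ≤ p') (h' : p' ≤ q) (h'' : q ≤ q') :
    R p q' ≤ R p' q :=
  (hR.mono h (h'.trans h'')).trans (hR.anti h' h'')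

theorem IsRankFunction.comap {P Q : Type*} [Preorder P] [Preorder Q] {R : Q → Q → ℕ}
    (hR : IsRankFunction R) {j : P → Q} (hj : Monotone j) :
    IsRankFunction fun a b => R (j a) (j b) where
  mono h h' := hR.mono (hj h) (hj h')
  anti h h' := hR.anti (hj h) (hj h')
  box h h' h'' := hR.box (hj h) (hj h') (hj h'')

/-- The number of classes with birth within `ε` of `b` and death within `ε` of `d`. -/
def rankBox (ρ : ℝ → ℝ → ℕ) (b d ε : ℝ) : ℕ :=
  (ρ (b + ε) (d - ε) + ρ (b - ε) (d + ε)) - (ρ (b - ε) (d - ε) + ρ (b + ε) (d + ε))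

open Classical in
/-- The diagram of a rank function, by the formulas for the diagram of a persistence module. -/
def rankDiagram (ρ : ℝ → ℝ → ℕ) : Diagram where
  finite p :=
    if p.1 < p.2 then
      sInf {m | ∃ ε : ℝ, 0 < ε ∧ p.1 + ε ≤ p.2 - ε ∧ m = rankBox ρ p.1 p.2 ε}
    else 0
  essential b :=
    sInf {m | ∃ ε t : ℝ, 0 < ε ∧ b + ε ≤ t ∧ m = ρ (b + ε) t - ρ (b - ε) t}

/-- The number of classes born up to `x` that die at `d`. -/
def deathCount (ρ : ℝ → ℝ → ℕ) (d x : ℝ) : ℕ :=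
  sInf ((fun ε => ρ x (d - ε) - ρ x (d + ε)) '' Set.Ioc 0 (d - x))

/-- The number of classes born up to `x` that never die. -/
def essentialCount (ρ : ℝ → ℝ → ℕ) (x : ℝ) : ℕ :=
  sInf (ρ x '' Set.Ici x)

theorem eventually_eq_sInf_image {α : Type*} {l : Filter α} {f : α → ℕ} {S : Set α}
    (hS : S.Nonempty) (h : ∀ x₀ ∈ S, ∀ᶠ x in l, x ∈ S ∧ f x ≤ f x₀) :
    ∀ᶠ x in l, f x = sInf (f '' S) := by
  obtain ⟨x₀, hx₀, hmin⟩ := Nat.sInf_mem (hS.image f)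
  filter_upwards [h x₀ hx₀] with x hx
  exact le_antisymm (hx.2.trans_eq hmin) (Nat.sInf_le ⟨x, hx.1, rfl⟩)

theorem tendsto_add_nhdsGT (b : ℝ) : Tendsto (fun ε => b + ε) (𝓝[>] 0) (𝓝[>] b) :=
  map_add_left_nhdsGT.le.trans_eq (by rw [add_zero])

theorem tendsto_sub_nhdsLT (b : ℝ) : Tendsto (fun ε => b - ε) (𝓝[>] 0) (𝓝[<] b) := by
  have h : Tendsto (b + ·) (𝓝[<] 0) (𝓝[<] b) := map_add_left_nhdsLT.le.trans_eq (by rw [add_zero])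
  have hneg : Tendsto Neg.neg (𝓝[>] (0 : ℝ)) (𝓝[<] 0) := by
    simpa only [neg_zero] using tendsto_neg_nhdsGT (a := (0 : ℝ))
  exact (h.comp hneg).congr fun ε => (sub_eq_add_neg b ε).symm

namespace IsRankFunction

variable {ρ ρ' : ℝ → ℝ → ℕ} (hρ : IsRankFunction ρ) (hρ' : IsRankFunction ρ') {x x' d t b : ℝ}

include hρ

theorem eventually_eq_deathCount (hx : x < d) :
    ∀ᶠ ε in 𝓝[>] 0, ρ x (d - ε) - ρ x (d + ε) = deathCount ρ d x := by
  refine eventually_eq_sInf_image (Set.nonempty_Ioc.2 (sub_pos.2 hx)) fun ε₀ hε₀ => ?_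
  filter_upwards [Ioc_mem_nhdsGT hε₀.1] with ε hε
  refine ⟨⟨hε.1, hε.2.trans hε₀.2⟩, tsub_le_tsub (hρ.anti ?_ ?_) (hρ.anti ?_ ?_)⟩
  all_goals linarith [hε.1, hε.2, hε₀.2]

theorem eventually_deathCount_add (ht : t < d) :
    ∀ᶠ ε in 𝓝[>] 0, ∀ x ≤ t, deathCount ρ d x + ρ x (d + ε) = ρ x (d - ε) := by
  obtain ⟨ε₀, hε₀, hconst⟩ := mem_nhdsGT_iff_exists_Ioc_subset.1 (hρ.eventually_eq_deathCount ht)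
  filter_upwards [Ioc_mem_nhdsGT (lt_min hε₀ (sub_pos.2 ht))] with ε ⟨hε, hε_le⟩ x hx
  have hεt := hε_le.trans (min_le_right _ _)
  obtain ⟨ε', hε'x, hε', hε'ε⟩ := ((hρ.eventually_eq_deathCount (hx.trans_lt ht)).and
    (Ioc_mem_nhdsGT hε)).exists
  have ht_eq : ρ t (d - ε) - ρ t (d + ε) = ρ t (d - ε') - ρ t (d + ε') :=
    (hconst ⟨hε, hε_le.trans (min_le_left _ _)⟩).trans
      (hconst ⟨hε', hε'ε.trans (hε_le.trans (min_le_left _ _))⟩).symm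
  have hbox₁ := hρ.box (q := d - ε) (q' := d - ε') hx (by linarith) (by linarith)
  have hbox₂ := hρ.box (q := d + ε') (q' := d + ε) hx (by linarith) (by linarith)
  have hx_anti := hρ.anti (p := x) (q := d - ε') (q' := d + ε') (by linarith) (by linarith)
  have ht_anti := hρ.anti (p := t) (q := d - ε') (q' := d + ε') (by linarith) (by linarith)
  have hx₁ := hρ.anti (p := x) (q := d - ε) (q' := d - ε') (by linarith) (by linarith)
  have hx₂ := hρ.anti (p := x) (q := d + ε') (q' := d + ε) (by linarith) (by linarith)
  omega

theorem monotoneOn_deathCount : MonotoneOn (deathCount ρ d) (Set.Iio d) := by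
  intro x _ x' hx' hxx'
  obtain ⟨ε, hε, hε0, hεd⟩ := ((hρ.eventually_deathCount_add hx').and
    (Ioc_mem_nhdsGT (sub_pos.2 hx'))).exists
  have hbox := hρ.box (q := d - ε) (q' := d + ε) hxx' (by linarith) (by linarith)
  have h₁ := hε x hxx'
  have h₂ := hε x' le_rfl
  omega

theorem eventually_rankBox_eq_finite (hb : b < d) :
    ∀ᶠ ε in 𝓝[>] 0, rankBox ρ b d ε = (rankDiagram ρ).finite (b, d) := by
  have hfin : (rankDiagram ρ).finite (b, d) =
      sInf (rankBox ρ b d '' {ε | 0 < ε ∧ b + ε ≤ d - ε}) := by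
    refine (if_pos hb).trans (congrArg sInf (Set.ext fun m => ?_))
    simp only [Set.mem_ofPred_eq, Set.mem_image, and_assoc, eq_comm]
  rw [hfin]
  refine eventually_eq_sInf_image ⟨(d - b) / 2, by linarith, by linarith⟩ fun ε₀ ⟨hε₀, hbd⟩ => ?_
  filter_upwards [Ioc_mem_nhdsGT hε₀] with ε ⟨hε, hεε₀⟩
  have hleft := hρ.box (p := b - ε₀) (p' := b - ε) (q := d - ε₀) (q' := d + ε₀)
    (by linarith) (by linarith) (by linarith)
  have hright := hρ.box (p := b + ε) (p' := b + ε₀) (q := d - ε₀) (q' := d + ε₀)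
    (by linarith) (by linarith) (by linarith)
  have hbelow := hρ.box (p := b - ε) (p' := b + ε) (q := d - ε₀) (q' := d - ε)
    (by linarith) (by linarith) (by linarith)
  have habove := hρ.box (p := b - ε) (p' := b + ε) (q := d + ε) (q' := d + ε₀)
    (by linarith) (by linarith) (by linarith)
  refine ⟨⟨hε, by linarith⟩, ?_⟩
  unfold rankBox
  omega

theorem eventually_rankBox_eq_jump (hb : b < d) :
    ∀ᶠ ε in 𝓝[>] 0, rankBox ρ b d ε = jump (deathCount ρ d) b := by
  obtain ⟨t, hbt, htd⟩ := exists_between hb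
  have hmem := Iio_mem_nhds hb
  filter_upwards [hρ.eventually_deathCount_add htd, Ioc_mem_nhdsGT (sub_pos.2 hbt),
    (tendsto_sub_nhdsLT b).eventually (eventually_eq_leftLim hρ.monotoneOn_deathCount hmem),
    (tendsto_add_nhdsGT b).eventually (eventually_eq_rightLim hρ.monotoneOn_deathCount hmem)]
    with ε hdeath ⟨hε, hεt⟩ hleft hright
  have h₁ := hdeath (b - ε) (by linarith)
  have h₂ := hdeath (b + ε) (by linarith)
  rw [jump, ← hleft, ← hright, rankBox]
  omega

theorem finite_eq_jump (hb : b < d) :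
    (rankDiagram ρ).finite (b, d) = jump (deathCount ρ d) b := by
  obtain ⟨ε, hfin, hjump⟩ :=
    ((hρ.eventually_rankBox_eq_finite hb).and (hρ.eventually_rankBox_eq_jump hb)).exists
  exact hfin.symm.trans hjump

theorem eventually_eq_essentialCount (x : ℝ) : ∀ᶠ y in atTop, ρ x y = essentialCount ρ x := by
  refine eventually_eq_sInf_image Set.nonempty_Ici fun y₀ hy₀ => ?_
  filter_upwards [eventually_ge_atTop y₀] with y hy
  exact ⟨hy₀.trans hy, hρ.anti hy₀ hy⟩

theorem monotone_essentialCount : Monotone (essentialCount ρ) := by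
  intro x x' hx
  obtain ⟨y, ⟨hy, hy'⟩, hxy⟩ := ((hρ.eventually_eq_essentialCount x).and
    (hρ.eventually_eq_essentialCount x')).and (eventually_ge_atTop x') |>.exists
  exact hy ▸ hy' ▸ hρ.mono hx hxy

theorem eventually_strip_eq_essential (b : ℝ) : ∀ᶠ p : ℝ × ℝ in 𝓝[>] 0 ×ˢ atTop,
    ρ (b + p.1) p.2 - ρ (b - p.1) p.2 = (rankDiagram ρ).essential b := by
  let strip (p : ℝ × ℝ) := ρ (b + p.1) p.2 - ρ (b - p.1) p.2
  have hess : (rankDiagram ρ).essential b = sInf (strip '' {p | 0 < p.1 ∧ b + p.1 ≤ p.2}) := by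
    refine congrArg sInf (Set.ext fun m => ?_)
    simp only [strip, Set.mem_ofPred_eq, Set.mem_image, Prod.exists, and_assoc, eq_comm]
  rw [hess]
  refine eventually_eq_sInf_image (f := strip) ⟨(1, b + 1), one_pos, le_rfl⟩
    fun ⟨ε₀, t₀⟩ ⟨hε₀, ht₀⟩ => ?_
  filter_upwards [prod_mem_prod (Ioc_mem_nhdsGT hε₀) (Ici_mem_atTop t₀)]
    with ⟨ε, t⟩ ⟨⟨hε, hεε₀⟩, ht⟩
  simp only [Set.mem_Ici] at hε hεε₀ ht ht₀
  have hbox := hρ.box (p := b - ε) (p' := b + ε) (q := t₀) (q' := t)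
    (by linarith) (by linarith) ht
  have hleft := hρ.mono (p := b - ε₀) (p' := b - ε) (q := t₀) (by linarith) (by linarith)
  have hright := hρ.mono (p := b + ε) (p' := b + ε₀) (q := t₀) (by linarith) (by linarith)
  refine ⟨⟨hε, (by linarith : b + ε ≤ t)⟩, ?_⟩
  simp only [strip]
  omega

theorem essential_eq_jump (b : ℝ) :
    (rankDiagram ρ).essential b = jump (essentialCount ρ) b := by
  have hmono := hρ.monotone_essentialCount.monotoneOn Set.univ
  obtain ⟨ε, hε, hleft, hright⟩ := ((hρ.eventually_strip_eq_essential b).curry.and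
    (((tendsto_sub_nhdsLT b).eventually (eventually_eq_leftLim hmono univ_mem)).and
    ((tendsto_add_nhdsGT b).eventually (eventually_eq_rightLim hmono univ_mem)))).exists
  obtain ⟨t, ht, htl, htr⟩ := (hε.and ((hρ.eventually_eq_essentialCount (b - ε)).and
    (hρ.eventually_eq_essentialCount (b + ε)))).exists
  rw [← ht, jump, ← hleft, ← hright, ← htl, ← htr]

theorem isJumpCount_finite :
    IsJumpCount (Equiv.prodComm ℝ ℝ) Set.Iio (deathCount ρ) (rankDiagram ρ).finite where
  isOpen _ := isOpen_Iio
  isLowerSet := isLowerSet_Iio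
  monotoneOn _ := hρ.monotoneOn_deathCount
  eq_jump _ := hρ.finite_eq_jump
  eq_zero _ h := if_neg h

theorem isJumpCount_essential :
    IsJumpCount (Equiv.punitProd ℝ).symm (fun _ => Set.univ) (fun _ => essentialCount ρ)
      (rankDiagram ρ).essential where
  isOpen _ := isOpen_univ
  isLowerSet _ := isLowerSet_univ
  monotoneOn _ := hρ.monotone_essentialCount.monotoneOn _
  eq_jump b _ := hρ.essential_eq_jump b
  eq_zero _ h := (h trivial).elim

include hρ'

theorem deathCount_le (hx : x < d) (hx' : x' < d)
    (h : ∀ y y', x ≤ y → x' ≤ y → y ≤ y' → ρ x y + ρ' x' y' ≤ ρ x y' + ρ' x' y) :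
    deathCount ρ d x ≤ deathCount ρ' d x' := by
  obtain ⟨ε, ⟨hε, hε'⟩, hε0, hεd⟩ := ((hρ.eventually_deathCount_add hx).and
    (hρ'.eventually_deathCount_add hx')).and
    (Ioc_mem_nhdsGT (lt_min (sub_pos.2 hx) (sub_pos.2 hx'))) |>.exists
  have hεx := hεd.trans (min_le_left _ _)
  have hεx' := hεd.trans (min_le_right _ _)
  have hbox := h (d - ε) (d + ε) (by linarith) (by linarith) (by linarith)
  have h₁ := hε x le_rfl
  have h₂ := hε' x' le_rfl
  omega

theorem essentialCount_le {K : ℝ} (h : ∀ᶠ y in atTop, ρ x (y + K) ≤ ρ' x' y) :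
    essentialCount ρ x ≤ essentialCount ρ' x' := by
  obtain ⟨y, ⟨hy, hy'⟩, hle⟩ := (((tendsto_atTop_add_const_right _ K tendsto_id).eventually
    (hρ.eventually_eq_essentialCount x)).and (hρ'.eventually_eq_essentialCount x')).and h |>.exists
  exact hy ▸ hy' ▸ hle

end IsRankFunction

/-- The rank function read in the opposite order, which exchanges births and deaths. -/
def dualRank (ρ : ℝ → ℝ → ℕ) (a b : ℝ) : ℕ := ρ (-b) (-a)

/-- The rank function of the module shifted by `κ`. -/
def shiftRank (κ : ℝ) (ρ : ℝ → ℝ → ℕ) (a b : ℝ) : ℕ := ρ (a + κ) (b + κ)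

theorem rankBox_dualRank (ρ : ℝ → ℝ → ℕ) (b d ε : ℝ) :
    rankBox (dualRank ρ) (-d) (-b) ε = rankBox ρ b d ε := by
  have hadd (x : ℝ) : -(-x + ε) = x - ε := by ring
  have hsub (x : ℝ) : -(-x - ε) = x + ε := by ring
  simp only [rankBox, dualRank, hadd, hsub]
  congr 1
  exact add_comm _ _

theorem finite_dualRank (ρ : ℝ → ℝ → ℕ) (b d : ℝ) :
    (rankDiagram (dualRank ρ)).finite (-d, -b) = (rankDiagram ρ).finite (b, d) := by
  simp only [rankDiagram, rankBox_dualRank, neg_lt_neg_iff]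
  refine if_congr Iff.rfl (congrArg sInf (Set.ext fun m => ?_)) rfl
  refine exists_congr fun ε => and_congr_right fun _ => and_congr_left fun _ => ?_
  constructor <;> intro h <;> linarith

theorem finite_shiftRank (κ : ℝ) (ρ : ℝ → ℝ → ℕ) (b d : ℝ) :
    (rankDiagram (shiftRank κ ρ)).finite (b, d) = (rankDiagram ρ).finite (b + κ, d + κ) := by
  simp only [rankDiagram, rankBox, shiftRank, add_right_comm _ κ, add_sub_right_comm _ κ,
    add_lt_add_iff_right, add_le_add_iff_right]

theorem essential_shiftRank (κ : ℝ) (ρ : ℝ → ℝ → ℕ) (b : ℝ) :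
    (rankDiagram (shiftRank κ ρ)).essential b = (rankDiagram ρ).essential (b + κ) := by
  simp only [rankDiagram, shiftRank, add_right_comm b κ, add_sub_right_comm b κ]
  refine congrArg sInf (Set.ext fun m => ?_)
  refine exists_congr fun ε => (Equiv.addRight κ).exists_congr fun t => ?_
  simp only [Equiv.coe_addRight, add_le_add_iff_right]

namespace IsRankFunction

section Dual

variable {ρ : ℝ → ℝ → ℕ} (hρ : IsRankFunction ρ)

include hρ

theorem dualRank : IsRankFunction (dualRank ρ) where
  mono h h' := hρ.anti (neg_le_neg h') (neg_le_neg h)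
  anti h h' := hρ.mono (neg_le_neg h') (neg_le_neg h)
  box h h' h'' := by
    have := hρ.box (neg_le_neg h'') (neg_le_neg h') (neg_le_neg h)
    simp only [MultiMapper.dualRank]
    omega

theorem shiftRank (κ : ℝ) : IsRankFunction (shiftRank κ ρ) :=
  hρ.comap fun _ _ h => add_le_add_left h κ

theorem isJumpCount_finite_dualRank :
    IsJumpCount ((Equiv.neg ℝ).prodCongr (Equiv.neg ℝ)) Set.Iio
      (deathCount (MultiMapper.dualRank ρ)) (rankDiagram ρ).finite :=
  hρ.dualRank.isJumpCount_finite.comap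
    (((Equiv.neg ℝ).prodCongr (Equiv.neg ℝ)).trans (Equiv.prodComm ℝ ℝ))
    fun (b, d) => finite_dualRank ρ b d

theorem isJumpCount_finite_shiftRank (κ : ℝ) :
    IsJumpCount (((Equiv.subRight κ).prodCongr (Equiv.subRight κ)).trans (Equiv.prodComm ℝ ℝ))
      Set.Iio (deathCount (MultiMapper.shiftRank κ ρ)) (rankDiagram ρ).finite := by
  refine (hρ.shiftRank κ).isJumpCount_finite.comap _ fun (b, d) => ?_
  simp [finite_shiftRank]

theorem isJumpCount_essential_shiftRank (κ : ℝ) :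
    IsJumpCount ((Equiv.subRight κ).trans (Equiv.punitProd ℝ).symm) (fun _ => Set.univ)
      (fun _ => essentialCount (MultiMapper.shiftRank κ ρ)) (rankDiagram ρ).essential := by
  refine (hρ.shiftRank κ).isJumpCount_essential.comap _ fun b => ?_
  simp [essential_shiftRank]

end Dual

section Comparison

variable {β β' : Type} {E : β ≃ ℝ × ℝ} {E' : β' ≃ ℝ × ℝ} {m : β → ℕ} {m' : β' → ℕ}
  {ρ ρ' : ℝ → ℝ → ℕ} {K : ℝ}

theorem exists_death_matching (hρ : IsRankFunction ρ) (hρ' : IsRankFunction ρ') (hK : 0 ≤ K)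
    (hm : IsJumpCount E Set.Iio (deathCount ρ) m) (hm' : IsJumpCount E' Set.Iio (deathCount ρ') m')
    (hle : ∀ x y y', x ≤ y → y ≤ y' → ρ x y + ρ' x y' ≤ ρ x y' + ρ' x y)
    (hge : ∀ x y y', x ≤ y → y ≤ y' → ρ' (x - K) y + ρ x y' ≤ ρ' (x - K) y' + ρ x y) :
    ∃ e : Points m → Points m', Function.Injective e ∧
      (∀ p, (E' (e p).1).1 = (E p.1).1 ∧ (E' (e p).1).2 ≤ (E p.1).2 ∧
        (E p.1).2 ≤ (E' (e p).1).2 + K) ∧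
      ∀ q, q ∉ Set.range e → (E' q.1).1 ≤ (E' q.1).2 + K := by
  obtain ⟨e, he, hpos, hunmatched⟩ := hm.exists_matching hm' hK
    (fun d x hx => hρ.deathCount_le hρ' hx hx fun y y' hy _ => hle x y y' hy)
    (fun d x hx => hρ'.deathCount_le hρ ((sub_le_self x hK).trans_lt hx) hx
      fun y y' _ hy => hge x y y' hy)
  exact ⟨e, he, hpos, fun q hq => le_of_forall_lt_imp_le_of_dense (hunmatched q hq)⟩

end Comparison

end IsRankFunction

/-! ### Stability of diagrams -/

/-- Two copies of the real line, indexed by `side`, in which moving to the other copy costs `η`.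
A functor on this preorder restricts to two persistence modules that are `η`-interleaved. -/
structure InterleavedLine (η : ℝ≥0) where
  side : Bool
  pos : ℝ

namespace InterleavedLine

variable {η : ℝ≥0}

instance : Preorder (InterleavedLine η) where
  le p q := p.pos + (if p.side = q.side then 0 else (η : ℝ)) ≤ q.pos
  le_refl p := by simp
  le_trans p q r hpq hqr := by
    rcases p with ⟨_ | _, p⟩ <;> rcases q with ⟨_ | _, q⟩ <;> rcases r with ⟨_ | _, r⟩ <;>
      simp only [reduceIte, reduceCtorEq] at hpq hqr ⊢ <;>
      linarith [η.coe_nonneg]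

theorem le_iff {p q : InterleavedLine η} :
    p ≤ q ↔ p.pos + (if p.side = q.side then 0 else (η : ℝ)) ≤ q.pos :=
  Iff.rfl

theorem mk_le_mk_self {i : Bool} {a b : ℝ} : (⟨i, a⟩ : InterleavedLine η) ≤ ⟨i, b⟩ ↔ a ≤ b := by
  simp [le_iff]

theorem mk_le_mk_not {i j : Bool} (hij : i ≠ j) {a b : ℝ} :
    (⟨i, a⟩ : InterleavedLine η) ≤ ⟨j, b⟩ ↔ a + η ≤ b := by
  simp [le_iff, hij]

end InterleavedLine

/-- The rank function of the restriction to the copy `i` of the real line. -/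
def sideRank {η : ℝ≥0} (R : InterleavedLine η → InterleavedLine η → ℕ) (i : Bool) (a b : ℝ) : ℕ :=
  R ⟨i, a⟩ ⟨i, b⟩

/-- The rank function of the image of the shift morphism from the copy `false` of the real line to
the copy `true`. -/
def crossRank {η : ℝ≥0} (R : InterleavedLine η → InterleavedLine η → ℕ) (a b : ℝ) : ℕ :=
  R ⟨false, a⟩ ⟨true, b + η⟩

theorem exists_pequiv_of_injective {T P Q : Type*} {e : T → P} {e' : T → Q}
    (he : Function.Injective e) (he' : Function.Injective e') :
    ∃ μ : P ≃. Q, (∀ p q, q ∈ μ p → ∃ t, e t = p ∧ e' t = q) ∧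
      (∀ p, μ p = none → p ∉ Set.range e) ∧ ∀ q, μ.symm q = none → q ∉ Set.range e' := by
  have hinv : ∀ p q, (Function.partialInv e' q).map e = some p ↔
      (Function.partialInv e p).map e' = some q := fun p q => by
    simp only [Option.map_eq_some_iff, he.isPartialInv _ _, he'.isPartialInv _ _, and_comm]
  let μ : P ≃. Q := ⟨fun p => (Function.partialInv e p).map e',
    fun q => (Function.partialInv e' q).map e, hinv⟩
  refine ⟨μ, fun p q hq => ?_, ?_, ?_⟩
  · obtain ⟨t, ht, htq⟩ := Option.map_eq_some_iff.1 hq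
    exact ⟨t, (he.isPartialInv _ _).1 ht, htq⟩
  · rintro _ hp ⟨t, rfl⟩
    simp [μ, Function.partialInv_left he] at hp
  · rintro _ hq ⟨t, rfl⟩
    simp [μ, PEquiv.symm, Function.partialInv_left he'] at hq

theorem edist_le_coe_of_abs_sub_le {x y : ℝ × ℝ} {η : ℝ≥0} (h₁ : |x.1 - y.1| ≤ η)
    (h₂ : |x.2 - y.2| ≤ η) : edist x y ≤ η :=
  edist_le_coe.2 (max_le h₁ h₂)

namespace IsRankFunction

open InterleavedLine

variable {η : ℝ≥0} {R : InterleavedLine η → InterleavedLine η → ℕ} (hR : IsRankFunction R)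

include hR

theorem sideRank (i : Bool) : IsRankFunction (sideRank R i) :=
  hR.comap fun _ _ h => InterleavedLine.mk_le_mk_self.2 h

theorem crossRank : IsRankFunction (crossRank R) where
  mono h h' := hR.mono (mk_le_mk_self.2 h) ((mk_le_mk_not (by decide)).2 (by gcongr))
  anti h h' := hR.anti ((mk_le_mk_not (by decide)).2 (by gcongr)) (mk_le_mk_self.2 (by gcongr))
  box h h' h'' := hR.box (mk_le_mk_self.2 h) ((mk_le_mk_not (by decide)).2 (by gcongr))
    (mk_le_mk_self.2 (by gcongr))

theorem exists_matching_crossRank_left :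
    ∃ e : Points (rankDiagram (MultiMapper.crossRank R)).finite →
        Points (rankDiagram (MultiMapper.sideRank R false)).finite, Function.Injective e ∧
      (∀ p, (e p).1.1 = p.1.1 ∧ p.1.2 ≤ (e p).1.2 ∧ (e p).1.2 ≤ p.1.2 + 2 * η) ∧
      ∀ q, q ∉ Set.range e → q.1.2 - q.1.1 ≤ 2 * η := by
  have hη : (0 : ℝ) ≤ 2 * η := by positivity
  obtain ⟨e, he, hpos, hunmatched⟩ := exists_death_matching hR.crossRank.dualRank
    (hR.sideRank false).dualRank hη hR.crossRank.isJumpCount_finite_dualRank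
    (hR.sideRank false).isJumpCount_finite_dualRank
    (fun x y y' hxy hyy' => by
      have hbox := hR.box (p := ⟨false, -y'⟩) (p' := ⟨false, -y⟩) (q := ⟨false, -x⟩)
        (q' := ⟨true, -x + η⟩) (mk_le_mk_self.2 (by linarith)) (mk_le_mk_self.2 (by linarith))
        ((mk_le_mk_not (by decide)).2 le_rfl)
      simp only [MultiMapper.dualRank, MultiMapper.sideRank, MultiMapper.crossRank]
      omega)
    (fun x y y' hxy hyy' => by
      have hbox := hR.box (p := ⟨false, -y'⟩) (p' := ⟨false, -y⟩) (q := ⟨true, -x + η⟩)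
        (q' := ⟨false, -(x - 2 * η)⟩) (mk_le_mk_self.2 (by linarith))
        ((mk_le_mk_not (by decide)).2 (by linarith)) ((mk_le_mk_not (by decide)).2 (by linarith))
      simp only [MultiMapper.dualRank, MultiMapper.sideRank, MultiMapper.crossRank]
      omega)
  simp only [Equiv.prodCongr_apply, Prod.map, Equiv.neg_apply, neg_inj] at hpos hunmatched
  refine ⟨e, he, fun p => ?_, fun q hq => ?_⟩
  · obtain ⟨hb, hd, hd'⟩ := hpos p
    exact ⟨hb, neg_le_neg_iff.1 hd, by linarith⟩
  · linarith [hunmatched q hq]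

theorem exists_matching_crossRank_right :
    ∃ e : Points (rankDiagram (MultiMapper.crossRank R)).finite →
        Points (rankDiagram (MultiMapper.sideRank R true)).finite, Function.Injective e ∧
      (∀ p, (e p).1.2 = p.1.2 + η ∧ (e p).1.1 ≤ p.1.1 + η ∧ p.1.1 ≤ (e p).1.1 + η) ∧
      ∀ q, q ∉ Set.range e → q.1.2 - q.1.1 ≤ 2 * η := by
  have hη : (0 : ℝ) ≤ 2 * η := by positivity
  obtain ⟨e, he, hpos, hunmatched⟩ := exists_death_matching hR.crossRank
    ((hR.sideRank true).shiftRank η) hη hR.crossRank.isJumpCount_finite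
    ((hR.sideRank true).isJumpCount_finite_shiftRank η)
    (fun x y y' hxy hyy' => by
      have hbox := hR.box (p := ⟨false, x⟩) (p' := ⟨true, x + η⟩) (q := ⟨true, y + η⟩)
        (q' := ⟨true, y' + η⟩) ((mk_le_mk_not (by decide)).2 le_rfl)
        (mk_le_mk_self.2 (by linarith)) (mk_le_mk_self.2 (by linarith))
      simp only [MultiMapper.shiftRank, MultiMapper.sideRank, MultiMapper.crossRank]
      omega)
    (fun x y y' hxy hyy' => by
      have hbox := hR.box (p := ⟨true, x - 2 * η + η⟩) (p' := ⟨false, x⟩) (q := ⟨true, y + η⟩)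
        (q' := ⟨true, y' + η⟩) ((mk_le_mk_not (by decide)).2 (by linarith))
        ((mk_le_mk_not (by decide)).2 (by linarith)) (mk_le_mk_self.2 (by linarith))
      simp only [MultiMapper.shiftRank, MultiMapper.sideRank, MultiMapper.crossRank]
      omega)
  simp only [Equiv.trans_apply, Equiv.prodCongr_apply, Prod.map, Equiv.subRight_apply,
    Equiv.prodComm_apply, Prod.swap_prod_mk, Prod.fst_swap, Prod.snd_swap] at hpos hunmatched
  refine ⟨e, he, fun p => ?_, fun q hq => ?_⟩
  · obtain ⟨hd, hb, hb'⟩ := hpos p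
    exact ⟨by linarith, by linarith, by linarith⟩
  · linarith [hunmatched q hq]

theorem exists_matchingCost_le :
    ∃ μ : Points (rankDiagram (MultiMapper.sideRank R false)).finite ≃.
      Points (rankDiagram (MultiMapper.sideRank R true)).finite, matchingCost μ ≤ η := by
  obtain ⟨e, he, hpos, hunmatched⟩ := hR.exists_matching_crossRank_left
  obtain ⟨e', he', hpos', hunmatched'⟩ := hR.exists_matching_crossRank_right
  obtain ⟨μ, hμ, hμl, hμr⟩ := exists_pequiv_of_injective he he'
  have hdiag {p : ℝ × ℝ} (hp : p.2 - p.1 ≤ 2 * η) : diagDist p ≤ η :=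
    ENNReal.ofReal_le_coe.2 (by linarith)
  refine ⟨μ, max_le (iSup_le fun p => iSup₂_le fun q hq => ?_) (max_le
    (iSup₂_le fun p hp => hdiag (hunmatched p (hμl p hp)))
    (iSup₂_le fun q hq => hdiag (hunmatched' q (hμr q hq))))⟩
  obtain ⟨t, rfl, rfl⟩ := hμ p q hq
  obtain ⟨hb, hd, hd'⟩ := hpos t
  obtain ⟨hd₁, hb₁, hb₁'⟩ := hpos' t
  exact edist_le_coe_of_abs_sub_le (abs_le.2 ⟨by linarith, by linarith⟩)
    (abs_le.2 ⟨by linarith, by linarith⟩)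

theorem exists_essential_equiv :
    ∃ e : Points (rankDiagram (MultiMapper.sideRank R false)).essential ≃
      Points (rankDiagram (MultiMapper.sideRank R true)).essential,
      ∀ p, edist p.1 (e p).1 ≤ η := by
  have hη : (0 : ℝ) ≤ 2 * η := by positivity
  have hfalse := hR.sideRank false
  have htrue := (hR.sideRank true).shiftRank η
  have hle (x : ℝ) : essentialCount (MultiMapper.sideRank R false) x ≤
      essentialCount (MultiMapper.shiftRank η (MultiMapper.sideRank R true)) x := by
    refine hfalse.essentialCount_le htrue (K := 2 * η) ?_
    filter_upwards [eventually_ge_atTop x] with y hy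
    exact hR.le_of_le_of_le ((mk_le_mk_not (by decide)).2 le_rfl)
      (mk_le_mk_self.2 (by linarith)) ((mk_le_mk_not (by decide)).2 (by linarith))
  have hge (x : ℝ) : essentialCount (MultiMapper.shiftRank η (MultiMapper.sideRank R true))
      (x - 2 * η) ≤ essentialCount (MultiMapper.sideRank R false) x := by
    refine htrue.essentialCount_le hfalse (K := 0) ?_
    filter_upwards [eventually_ge_atTop x] with y hy
    exact hR.le_of_le_of_le ((mk_le_mk_not (by decide)).2 (by linarith))
      (mk_le_mk_self.2 hy) ((mk_le_mk_not (by decide)).2 (by linarith))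
  obtain ⟨e, he, hpos, hunmatched⟩ := hfalse.isJumpCount_essential.exists_matching
    ((hR.sideRank true).isJumpCount_essential_shiftRank η) hη (fun _ x _ => hle x)
    (fun _ x _ => hge x)
  have hsurj : Function.Surjective e := fun q => by
    by_contra hq
    exact (lt_add_one _).not_ge (hunmatched q hq _ trivial)
  refine ⟨Equiv.ofBijective e ⟨he, hsurj⟩, fun p => ?_⟩
  obtain ⟨-, hle, hge⟩ := hpos p
  simp only [Equiv.trans_apply, Equiv.subRight_apply, Equiv.punitProd_symm_apply] at hle hge
  have hdist : |p.1 - (e p).1| ≤ η := abs_le.2 ⟨by linarith, by linarith⟩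
  exact edist_le_coe.2 hdist

theorem bottleneckDist_le :
    bottleneckDist (rankDiagram (MultiMapper.sideRank R false))
      (rankDiagram (MultiMapper.sideRank R true)) ≤ η := by
  obtain ⟨μ, hμ⟩ := hR.exists_matchingCost_le
  obtain ⟨e, he⟩ := hR.exists_essential_equiv
  exact iInf₂_le_of_le μ e (max_le hμ (iSup_le he))

end IsRankFunction

/-! ### Stability of persistence modules -/

theorem finrank_map_add_finrank_le {F V V' : Type*} [DivisionRing F] [AddCommGroup V] [Module F V]
    [AddCommGroup V'] [Module F V'] [Module.Finite F V] (T : V →ₗ[F] V') {P Q : Submodule F V}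
    (h : P ≤ Q) :
    Module.finrank F (Q.map T) + Module.finrank F P ≤
      Module.finrank F (P.map T) + Module.finrank F Q := by
  have rank_nullity (R : Submodule F V) : Module.finrank F (R.map T) +
      Module.finrank F (R ⊓ LinearMap.ker T : Submodule F V) = Module.finrank F R := by
    have := LinearMap.finrank_range_add_finrank_ker (T.domRestrict R)
    rwa [LinearMap.range_domRestrict, LinearMap.ker_domRestrict,
      ← Submodule.finrank_map_subtype_eq, Submodule.map_comap_subtype] at this
  have hker := Submodule.finrank_mono (inf_le_inf_right (LinearMap.ker T) h)
  linarith [rank_nullity P, rank_nullity Q]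

section ExtendedRank

variable {F : Type*} [Field F] {Q : Type*} [Preorder Q] {U : Set Q}

open Classical in
/-- The rank of the structure map from `p` to `q` of a functor on a subset `U` of a preorder, which
is extended by zero outside of `U`. -/
def extendedRank (M : U ⥤ ModuleCat.{v} F) (p q : Q) : ℕ :=
  if h : (p ∈ U ∧ q ∈ U) ∧ p ≤ q then
    Module.finrank F (LinearMap.range
      (M.map (homOfLE (show (⟨p, h.1.1⟩ : U) ≤ ⟨q, h.1.2⟩ from h.2))).hom)
  else 0

variable {M : U ⥤ ModuleCat.{v} F}

theorem extendedRank_eq {p q : U} (f : p ⟶ q) :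
    extendedRank M p q = Module.finrank F (LinearMap.range (M.map f).hom) :=
  dif_pos ⟨⟨p.2, q.2⟩, leOfHom f⟩

theorem extendedRank_eq_zero {p : Q} (hp : p ∉ U) (q : Q) : extendedRank M p q = 0 :=
  dif_neg fun h => hp h.1.1

theorem isRankFunction_extendedRank (hU : IsUpperSet U) (hM : ∀ p, Module.Finite F (M.obj p)) :
    IsRankFunction (extendedRank M) := by
  have anti {p q q' : Q} (h : p ≤ q) (h' : q ≤ q') : extendedRank M p q' ≤ extendedRank M p q := by
    by_cases hp : p ∈ U
    · lift p to U using hp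
      lift q to U using hU h p.2
      lift q' to U using hU h' q.2
      rw [extendedRank_eq (homOfLE h), extendedRank_eq (homOfLE h ≫ homOfLE h'), M.map_comp,
        ModuleCat.hom_comp, LinearMap.range_comp]
      exact Submodule.finrank_map_le _ _
    · simp only [extendedRank_eq_zero hp, le_rfl]
  refine ⟨fun {p p' q} h h' => ?_, anti, fun {p p' q q'} h h' h'' => ?_⟩
  · by_cases hp : p ∈ U
    · lift p to U using hp
      lift p' to U using hU h p.2
      lift q to U using hU h' p'.2
      rw [extendedRank_eq (homOfLE h'), extendedRank_eq (homOfLE h ≫ homOfLE h'), M.map_comp,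
        ModuleCat.hom_comp]
      exact Submodule.finrank_mono (LinearMap.range_comp_le_range _ _)
    · simp only [extendedRank_eq_zero hp, Nat.zero_le]
  · by_cases hp : p ∈ U
    · lift p to U using hp
      lift p' to U using hU h p.2
      lift q to U using hU h' p'.2
      lift q' to U using hU h'' q.2
      have hrange := LinearMap.range_comp_le_range (M.map (homOfLE h)).hom (M.map (homOfLE h')).hom
      rw [extendedRank_eq (homOfLE h'), extendedRank_eq (homOfLE h ≫ homOfLE h'),
        extendedRank_eq (homOfLE h' ≫ homOfLE h''),
        extendedRank_eq ((homOfLE h ≫ homOfLE h') ≫ homOfLE h''), M.map_comp _ (homOfLE h''),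
        M.map_comp _ (homOfLE h''), M.map_comp, ModuleCat.hom_comp, ModuleCat.hom_comp,
        ModuleCat.hom_comp, LinearMap.range_comp _ (M.map (homOfLE h'')).hom,
        LinearMap.range_comp _ (M.map (homOfLE h'')).hom]
      exact finrank_map_add_finrank_le _ hrange
    · simpa only [extendedRank_eq_zero hp, add_zero, zero_add] using anti h' h''

theorem finrank_range_eq_of_comp_eq {F V W V' W' : Type*} [Field F] [AddCommGroup V] [Module F V]
    [AddCommGroup W] [Module F W] [AddCommGroup V'] [Module F V'] [AddCommGroup W'] [Module F W']
    {T : V →ₗ[F] W} {T' : V' →ₗ[F] W'} (e : V ≃ₗ[F] V') (e' : W ≃ₗ[F] W')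
    (h : T' ∘ₗ e.toLinearMap = e'.toLinearMap ∘ₗ T) :
    Module.finrank F (LinearMap.range T) = Module.finrank F (LinearMap.range T') := by
  rw [← LinearMap.range_comp_of_range_eq_top T' e.range, h, LinearMap.range_comp]
  exact (LinearEquiv.finrank_map_eq e' _).symm

end ExtendedRank

section Stability

variable {F : Type u} [Field F] {r : ℝ} {η : ℝ≥0}

theorem persistentRank_eq_of_iso {M N : Set.Ici r ⥤ ModuleCat.{u} F} (e : M ≅ N) (a b : ℝ) :
    persistentRank M a b = persistentRank N a b := by
  unfold persistentRank
  split_ifs with h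
  · exact finrank_range_eq_of_comp_eq (e.app _).toLinearEquiv (e.app _).toLinearEquiv
      (congrArg ModuleCat.Hom.hom (e.hom.naturality _).symm)
  · rfl

theorem diagram_eq_of_iso {M N : Set.Ici r ⥤ ModuleCat.{u} F} (e : M ≅ N) :
    diagram M = diagram N := by
  have hrank : persistentRank M = persistentRank N :=
    funext₂ (persistentRank_eq_of_iso e)
  simp only [diagram, boxCount, stripCount, hrank]

namespace InterleavedLine

/-- The part of the two copies of the real line to the right of `r`. -/
def ray (r : ℝ) (η : ℝ≥0) : Set (InterleavedLine η) := {q | r ≤ q.pos}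

theorem isUpperSet_ray : IsUpperSet (ray r η) := fun p q hpq hp => by
  have hη : (0 : ℝ) ≤ if p.side = q.side then 0 else (η : ℝ) := by split_ifs <;> simp
  exact le_trans hp ((le_add_of_nonneg_right hη).trans hpq)

theorem monotone_inclusion (i : Bool) : Monotone fun a : Set.Ici r => (⟨⟨i, a⟩, a.2⟩ : ray r η) :=
  fun _ _ h => mk_le_mk_self.2 h

/-- The inclusion of the copy `i` of `[r, ∞)`. -/
abbrev inclusion (i : Bool) : Set.Ici r ⥤ ray r η := (monotone_inclusion i).functor

/-- Two monotone maps into a preorder, interleaved with each other, as one map. -/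
def join {P : Type*} (U U' : Set.Ici r → P) (q : ray r η) : P :=
  match q with
  | ⟨⟨false, a⟩, ha⟩ => U ⟨a, ha⟩
  | ⟨⟨true, a⟩, ha⟩ => U' ⟨a, ha⟩

theorem monotone_join {P : Type*} [Preorder P] {U U' : Set.Ici r → P} (hU : Monotone U)
    (hU' : Monotone U') (hUU' : ∀ a b : Set.Ici r, (a + η : ℝ) ≤ b → U a ≤ U' b)
    (hU'U : ∀ a b : Set.Ici r, (a + η : ℝ) ≤ b → U' a ≤ U b) :
    Monotone (join (η := η) U U') := by
  rintro ⟨⟨_ | _, a⟩, ha⟩ ⟨⟨_ | _, b⟩, hb⟩ h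
  · exact hU (mk_le_mk_self.1 h)
  · exact hUU' _ _ ((mk_le_mk_not (by decide)).1 h)
  · exact hU'U _ _ ((mk_le_mk_not (by decide)).1 h)
  · exact hU' (mk_le_mk_self.1 h)

end InterleavedLine

open InterleavedLine

theorem diagram_inclusion_comp (H : ray r η ⥤ ModuleCat.{u} F) (i : Bool) :
    diagram (inclusion i ⋙ H) = rankDiagram (sideRank (extendedRank H) i) := by
  have hrank : persistentRank (inclusion i ⋙ H) = sideRank (extendedRank H) i := by
    classical
    ext a b
    have hiff : r ≤ a ∧ a ≤ b ↔ ((⟨i, a⟩ ∈ ray r η) ∧ (⟨i, b⟩ ∈ ray r η)) ∧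
        (⟨i, a⟩ : InterleavedLine η) ≤ ⟨i, b⟩ :=
      ⟨fun h => ⟨⟨h.1, h.1.trans h.2⟩, mk_le_mk_self.2 h.2⟩, fun h => ⟨h.1.1, mk_le_mk_self.1 h.2⟩⟩
    exact dite_congr (propext hiff) (fun _ => rfl) fun _ => rfl
  rw [← hrank]
  rfl

/-- Algebraic stability: a functor on `ray r η` is a pair of `η`-interleaved persistence modules. -/
theorem bottleneckDist_diagram_inclusion_le (H : ray r η ⥤ ModuleCat.{u} F)
    (hH : ∀ q, Module.Finite F (H.obj q)) :
    bottleneckDist (diagram (inclusion false ⋙ H)) (diagram (inclusion true ⋙ H)) ≤ η := by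
  rw [diagram_inclusion_comp, diagram_inclusion_comp]
  exact (isRankFunction_extendedRank isUpperSet_ray hH).bottleneckDist_le

theorem bottleneckDist_diagram_le_of_iso {P : Type*} [Preorder P] {H : P ⥤ ModuleCat.{u} F}
    {U U' : Set.Ici r → P} {hU : Monotone U} {hU' : Monotone U'}
    (hUU' : ∀ a b : Set.Ici r, (a + η : ℝ) ≤ b → U a ≤ U' b)
    (hU'U : ∀ a b : Set.Ici r, (a + η : ℝ) ≤ b → U' a ≤ U b)
    {M N : Set.Ici r ⥤ ModuleCat.{u} F} (e : M ≅ hU.functor ⋙ H) (e' : N ≅ hU'.functor ⋙ H)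
    (hM : PointwiseFinite M) (hN : PointwiseFinite N) :
    bottleneckDist (diagram M) (diagram N) ≤ η := by
  rw [diagram_eq_of_iso e, diagram_eq_of_iso e']
  refine bottleneckDist_diagram_inclusion_le ((monotone_join hU hU' hUU' hU'U).functor ⋙ H) ?_
  rintro ⟨⟨_ | _, a⟩, ha⟩
  · have := hM ⟨a, ha⟩
    exact Module.Finite.equiv (e.app ⟨a, ha⟩).toLinearEquiv
  · have := hN ⟨a, ha⟩
    exact Module.Finite.equiv (e'.app ⟨a, ha⟩).toLinearEquiv

end Stability

/-! ### Homology of nerves -/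

/-- An indexed family of subsets of `X`. Families are preordered by refinement. -/
structure SetFamily (X : Type v) where
  ι : Type u
  sets : ι → Set X

instance {X : Type v} : Preorder (SetFamily.{u} X) where
  le U V := ∀ i, ∃ j, U.sets i ⊆ V.sets j
  le_refl U i := ⟨i, subset_rfl⟩
  le_trans U V W hUV hVW i :=
    let ⟨j, hj⟩ := hUV i
    let ⟨l, hl⟩ := hVW j
    ⟨l, hj.trans hl⟩

section Nerve

variable {X : Type v} {ι κ lam : Type u} {U : ι → Set X} {V : κ → Set X} {W : lam → Set X}

theorem range_simplex_nerve_iff {n : ℕ} (U : ι → Set X) (t : Fin (n + 1) → ι) :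
    (∃ σ ∈ (nerve U).faces, (σ : Set ι) = Set.range t) ↔ (⋂ j, U (t j)).Nonempty := by
  classical
  constructor
  · rintro ⟨σ, ⟨-, hσ⟩, hrange⟩
    simpa only [← Finset.mem_coe, hrange, Set.biInter_range] using hσ
  · intro ht
    refine ⟨Finset.univ.image t, ⟨⟨t 0, by simp⟩, ?_⟩, by simp⟩
    simpa only [← Finset.mem_coe, Finset.coe_image, Finset.coe_univ, Set.image_univ,
      Set.biInter_range] using ht

/-- The map of nerves induced by a map of index sets under which the members increase. -/
def nerveMap (φ : ι → κ) (hφ : ∀ i, U i ⊆ V (φ i)) :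
    orderedSSet (nerve U) ⟶ orderedSSet (nerve V) where
  app _ := ↾fun t => ⟨φ ∘ t.1, (range_simplex_nerve_iff V _).2
    (((range_simplex_nerve_iff U t.1).1 t.2).mono (Set.iInter_mono fun j => hφ (t.1 j)))⟩
  naturality _ _ _ := rfl

open MonoidalCategory Simplicial

/-- Any two maps of index sets under which the members increase are contiguous, so the maps of
nerves are homotopic. -/
def nerveMapHomotopy (φ ψ : ι → κ) (hφ : ∀ i, U i ⊆ V (φ i)) (hψ : ∀ i, U i ⊆ V (ψ i)) :
    SSet.Homotopy (nerveMap φ hφ) (nerveMap ψ hψ) where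
  h :=
    { app := fun n => ↾fun p => ⟨fun i =>
          if (SSet.stdSimplex.objEquiv p.2).toOrderHom i = 0 then φ (p.1.1 i) else ψ (p.1.1 i),
        (range_simplex_nerve_iff V _).2 (((range_simplex_nerve_iff U p.1.1).1 p.1.2).mono
          (Set.iInter_mono fun j => by split_ifs; exacts [hφ _, hψ _]))⟩
      naturality := fun _ _ _ => rfl }
  h₀ := rfl
  h₁ := rfl
  rel := by ext _ ⟨⟨_, ⟨⟩⟩, _⟩

theorem nerve_preimage {Y : Type*} {h : Y → X} (hh : Function.Surjective h) (U : ι → Set X) :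
    nerve (fun i => h ⁻¹' U i) = nerve U := by
  ext σ
  simp only [nerve, ← Set.preimage_iInter, hh.nonempty_preimage]

variable (F : Type u) [Field F] (k : ℕ)

/-- The homology of the nerve of a family of sets. -/
abbrev nerveHomology (U : ι → Set X) : ModuleCat.{u} F :=
  SSet.homology (orderedSSet (nerve U)) (ModuleCat.of F F) k

/-- The map on the homology of nerves induced by a map of index sets under which the members
increase. -/
def nerveHomologyMap (φ : ι → κ) (hφ : ∀ i, U i ⊆ V (φ i)) :
    nerveHomology F k U ⟶ nerveHomology F k V :=
  SSet.homologyMap (nerveMap φ hφ) (ModuleCat.of F F) k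

theorem nerveHomologyMap_congr (φ ψ : ι → κ) (hφ : ∀ i, U i ⊆ V (φ i))
    (hψ : ∀ i, U i ⊆ V (ψ i)) : nerveHomologyMap F k φ hφ = nerveHomologyMap F k ψ hψ :=
  (nerveMapHomotopy φ ψ hφ hψ).congr_homologyMap _ _

theorem nerveHomologyMap_comp (φ : ι → κ) (hφ : ∀ i, U i ⊆ V (φ i)) (ψ : κ → lam)
    (hψ : ∀ i, V i ⊆ W (ψ i)) :
    nerveHomologyMap F k φ hφ ≫ nerveHomologyMap F k ψ hψ =
      nerveHomologyMap F k (ψ ∘ φ) fun i => (hφ i).trans (hψ (φ i)) :=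
  (SSet.homologyMap_comp _ _ _ _ _ _ _).symm

/-- The homology of nerves as a functor on families. By contiguity it does not depend on how the
members of a family are assigned to members of a coarser one. -/
def nerveHomologyFunctor (X : Type v) : SetFamily.{u} X ⥤ ModuleCat.{u} F where
  obj U := nerveHomology F k U.sets
  map f := nerveHomologyMap F k (fun i => (leOfHom f i).choose) fun i => (leOfHom f i).choose_spec
  map_id _ := (nerveHomologyMap_congr F k _ id _ fun _ => subset_rfl).trans
    (SSet.homologyMap_id _ _ _)
  map_comp _ _ :=
    (nerveHomologyMap_congr F k _ _ _ _).trans (nerveHomologyMap_comp F k _ _ _ _).symm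

theorem finite_chainComplex_X (S : SSet.{u}) [Finite (S.obj (Opposite.op (SimplexCategory.mk k)))] :
    Module.Finite F ((S.chainComplex (ModuleCat.of F F)).X k) := by
  classical
  let J := S.obj (Opposite.op (SimplexCategory.mk k))
  have e := (S.isColimitChainComplexXCofan (ModuleCat.of F F) k).coconePointUniqueUpToIso
    (ModuleCat.coproductCoconeIsColimit (R := F) fun _ : J => ModuleCat.of F F)
  have : Fintype J := Fintype.ofFinite J
  have : Module.Finite F (ModuleCat.coproductCocone fun _ : J => ModuleCat.of F F).pt :=
    inferInstanceAs (Module.Finite F (DirectSum J fun _ => F))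
  exact Module.Finite.equiv e.toLinearEquiv.symm

theorem finite_homology (C : ChainComplex (ModuleCat.{u} F) ℕ) [Module.Finite F (C.X k)] :
    Module.Finite F (C.homology k) := by
  have : Module.Finite F (C.cycles k) := Module.Finite.of_injective (C.iCycles k).hom
    ((ModuleCat.mono_iff_injective _).1 inferInstance)
  exact Module.Finite.of_surjective (C.homologyπ k).hom
    ((ModuleCat.epi_iff_surjective _).1 inferInstance)

theorem finite_nerveHomology [Finite ι] (U : ι → Set X) :
    Module.Finite F (nerveHomology F k U) := by
  have : Finite ((orderedSSet (nerve U)).obj (Opposite.op (SimplexCategory.mk k))) :=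
    inferInstanceAs
      (Finite {t : Fin (k + 1) → ι // ∃ σ ∈ (nerve U).faces, (σ : Set ι) = Set.range t})
  have := finite_chainComplex_X F k (orderedSSet (nerve U))
  exact finite_homology F k _

end Nerve

namespace CoverTower

variable {X : Type v} (T : CoverTower.{u} X)

theorem monotone_setFamily : Monotone fun a => (⟨T.ι a, T.U a⟩ : SetFamily X) :=
  fun _ _ h i => ⟨T.map h i, T.subset_map h i⟩

/-- The homology of the nerves of a tower of covers depends only on the refinement relations. -/
def homologyNerveIso (F : Type u) [Field F] (k : ℕ) :
    T.nerve.homology F k ≅ T.monotone_setFamily.functor ⋙ nerveHomologyFunctor F k X :=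
  NatIso.ofComponents (fun _ => Iso.refl _) fun f =>
    (Category.comp_id _).trans ((nerveHomologyMap_congr F k (T.map (leOfHom f)) _
      (T.subset_map (leOfHom f)) _).trans (Category.id_comp _).symm)

/-- The tower of preimages under `h`. -/
def comap {Y : Type*} (h : Y → X) : CoverTower.{u} Y where
  res := T.res
  ι := T.ι
  U a i := h ⁻¹' T.U a i
  iUnion_eq a := by rw [← Set.preimage_iUnion, T.iUnion_eq, Set.preimage_univ]
  map := T.map
  subset_map hab i := Set.preimage_mono (T.subset_map hab i)
  map_refl := T.map_refl
  map_trans := T.map_trans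

theorem nerve_comap {Y : Type*} {h : Y → X} (hh : Function.Surjective h) :
    (T.comap h).nerve = T.nerve := by
  simp only [CoverTower.nerve, comap, nerve_preimage hh]
  rfl

end CoverTower

/-! ### Stability of the multiscale mapper -/

theorem exists_component_of_mapsTo {X Y : Type u} [TopologicalSpace X] [TopologicalSpace Y]
    {A : Set Y} {B : Set X} {h : Y → X} (hc : Continuous h) (hAB : Set.MapsTo h A B)
    (c : ZerothHomotopy A) :
    ∃ c' : ZerothHomotopy B, Set.MapsTo h (componentSet c) (componentSet c') := by
  have hj (x y : A) : Joined x y → Joined (hAB.restrict h A B x) (hAB.restrict h A B y) :=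
    fun ⟨p⟩ => ⟨p.map (hc.restrict hAB)⟩
  refine ⟨Quotient.map _ hj c, ?_⟩
  rintro y ⟨hy, rfl⟩
  exact ⟨hAB hy, rfl⟩

section Mapper

variable (F : Type u) [Field F] (k : ℕ) {X Y : Type u} {Z : Type v} [TopologicalSpace X]
  [TopologicalSpace Y]

theorem bottleneckDist_homology_MM_le (T : CoverTower.{u} Z) {f : Y → Z} {g : X → Z} (h : X ≃ₜ Y)
    {η : ℝ≥0} (hfg : ∀ a b : Set.Ici T.res, (a + η : ℝ) ≤ b → ∀ i, ∃ j,
      f ∘ h ⁻¹' T.U a i ⊆ g ⁻¹' T.U b j)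
    (hgf : ∀ a b : Set.Ici T.res, (a + η : ℝ) ≤ b → ∀ i, ∃ j,
      g ⁻¹' T.U a i ⊆ f ∘ h ⁻¹' T.U b j)
    (hf : PointwiseFinite ((MM T f).homology F k)) (hg : PointwiseFinite ((MM T g).homology F k)) :
    bottleneckDist (diagram ((MM T f).homology F k)) (diagram ((MM T g).homology F k)) ≤ η := by
  let V := (T.pullback f).comap h
  let V' := T.pullback g
  have hV : V.nerve = MM T f := (T.pullback f).nerve_comap h.surjective
  rw [← hV] at hf ⊢
  refine bottleneckDist_diagram_le_of_iso (r := T.res) ?_ ?_ (V.homologyNerveIso F k)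
    (V'.homologyNerveIso F k) hf hg
  · rintro a b hab ⟨i, c⟩
    obtain ⟨j, hj⟩ := hfg a b hab i
    obtain ⟨c', hc'⟩ := exists_component_of_mapsTo (A := f ⁻¹' T.U a i) (B := g ⁻¹' T.U b j)
      h.symm.continuous (fun y hy => hj (by simpa using hy)) c
    refine ⟨⟨j, c'⟩, fun x hx => ?_⟩
    have := hc' hx
    rwa [h.symm_apply_apply] at this
  · rintro a b hab ⟨i, c⟩
    obtain ⟨j, hj⟩ := hgf a b hab i
    obtain ⟨c', hc'⟩ := exists_component_of_mapsTo (A := g ⁻¹' T.U a i) (B := f ⁻¹' T.U b j)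
      h.continuous hj c
    exact ⟨⟨j, c'⟩, hc'⟩

end Mapper

/-! ### Good towers -/

section GoodTower

variable {Z : Type v} [MetricSpace Z] [PreconnectedSpace Z] {c s δ : ℝ}

theorem exists_dist_eq {z z' : Z} (hs : 0 ≤ s) (h : s ≤ dist z z') : ∃ w, dist z w = s :=
  intermediate_value_univ z z' (continuous_const.dist continuous_id)
    ⟨(dist_self z).trans_le hs, h⟩

theorem le_diam_cthickening {A : Set Z} (hne : A.Nonempty) (hbdd : Bornology.IsBounded A)
    (hs : 0 ≤ s) (hδ : s ≤ δ) (hZ : ENNReal.ofReal s ≤ Metric.ediam (Set.univ : Set Z)) :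
    s ≤ Metric.diam (Metric.cthickening δ A) := by
  obtain ⟨z, hz⟩ := hne
  have hbdd' : Bornology.IsBounded (Metric.cthickening δ A) := hbdd.cthickening
  have hball : Metric.closedBall z δ ⊆ Metric.cthickening δ A :=
    Metric.closedBall_subset_cthickening hz δ
  by_cases hall : ∃ z', δ < dist z z'
  · obtain ⟨z', hz'⟩ := hall
    obtain ⟨w, hw⟩ := exists_dist_eq hs (hδ.trans hz'.le)
    exact hw ▸ Metric.dist_le_diam_of_mem hbdd' (Metric.self_subset_cthickening A hz)
      (hball (Metric.mem_closedBall'.2 (hw.trans_le hδ)))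
  · push Not at hall
    have huniv : Metric.cthickening δ A = Set.univ :=
      Set.eq_univ_of_forall fun z' => hball (Metric.mem_closedBall'.2 (hall z'))
    rwa [← huniv, ENNReal.ofReal_le_iff_le_toReal hbdd'.ediam_ne_top] at hZ

theorem CoverTower.IsGood.exists_cthickening_subset {W : CoverTower.{u} Z} (hgood : W.IsGood c s)
    (hδ : s ≤ δ) {a b : Set.Ici W.res} (hab : c * (a + 2 * δ) ≤ b) (i : W.ι a)
    (hne : (W.U a i).Nonempty) : ∃ j : W.ι b, Metric.cthickening δ (W.U a i) ⊆ W.U b j := by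
  have hc : 0 ≤ c := zero_le_one.trans hgood.one_le
  have ha : 0 ≤ (a : ℝ) := hgood.res_pos.le.trans a.2
  have hbdd : Bornology.IsBounded (W.U a i) := Metric.isBounded_iff_ediam_ne_top.2
    ((hgood.diam_le a i).trans_lt ENNReal.ofReal_lt_top).ne
  have hdiam : Metric.diam (Metric.cthickening δ (W.U a i)) ≤ a + 2 * δ :=
    (Metric.diam_cthickening_le _ (hgood.pos.le.trans hδ)).trans
      (add_le_add_left (ENNReal.toReal_le_of_le_ofReal ha (hgood.diam_le a i)) _)
  have hsdiam := le_diam_cthickening hne hbdd hgood.pos.le hδ hgood.le_diam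
  have hres : W.res ≤ c * Metric.diam (Metric.cthickening δ (W.U a i)) :=
    hgood.res_eq.trans_le (hsdiam.trans (le_mul_of_one_le_left Metric.diam_nonneg hgood.one_le))
  obtain ⟨j, hj⟩ := hgood.exists_superset _ hbdd.cthickening hsdiam ⟨_, hres⟩ rfl
  exact ⟨_, hj.trans (W.subset_map ((mul_le_mul_of_nonneg_left hdiam hc).trans hab) j)⟩

theorem mul_exp_add_le_exp {a b : ℝ} (hc : 1 ≤ c) (hδ : 0 ≤ δ) (ha : Real.log s ≤ a)
    (hab : a + (Real.log (2 * c * δ + c) + max 0 (Real.log (1 / s))) ≤ b) :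
    c * (Real.exp a + 2 * δ) ≤ Real.exp b := by
  set m := max 0 (Real.log (1 / s)) with hm
  have hcδ : 0 ≤ c * δ := mul_nonneg (zero_le_one.trans hc) hδ
  have hpos : 0 < 2 * c * δ + c := by linarith
  have ham : 0 ≤ a + m := by
    have := le_max_right 0 (Real.log (1 / s))
    rw [← hm, one_div, Real.log_inv] at this
    linarith
  calc c * (Real.exp a + 2 * δ) = c * Real.exp a + 2 * (c * δ) * 1 := by ring
    _ ≤ c * Real.exp (a + m) + 2 * (c * δ) * Real.exp (a + m) := by
        gcongr
        · exact le_add_of_nonneg_right (le_max_left _ _)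
        · exact Real.one_le_exp ham
    _ = Real.exp (a + m) * (2 * c * δ + c) := by ring
    _ = Real.exp (a + (Real.log (2 * c * δ + c) + m)) := by
        rw [add_comm (Real.log _), ← add_assoc, Real.exp_add (a + m), Real.exp_log hpos]
    _ ≤ Real.exp b := Real.exp_le_exp.2 hab

theorem CoverTower.IsGood.exists_cthickening_subset_reindexLog {W : CoverTower.{u} Z}
    (hgood : W.IsGood c s) (hW : W.IsOpenTower) (hδ : s ≤ δ) {a b : Set.Ici (Real.log W.res)}
    (hab : (a + (Real.log (2 * c * δ + c) + max 0 (Real.log (1 / s))).toNNReal : ℝ) ≤ b)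
    (i : (W.reindexLog hgood.res_pos).ι a) :
    ∃ j : (W.reindexLog hgood.res_pos).ι b,
      Metric.cthickening δ ((W.reindexLog hgood.res_pos).U a i) ⊆
        (W.reindexLog hgood.res_pos).U b j := by
  have hlog : Real.log s ≤ a := (congrArg Real.log hgood.res_eq).ge.trans a.2
  have hexp : c * (Real.exp a + 2 * δ) ≤ Real.exp b :=
    mul_exp_add_le_exp hgood.one_le (hgood.pos.le.trans hδ) hlog
      ((add_le_add_right (Real.le_coe_toNNReal _) _).trans hab)
  exact hgood.exists_cthickening_subset hδ (a := expIci hgood.res_pos a)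
    (b := expIci hgood.res_pos b) hexp i (hW.isPathConnected _ i).nonempty

end GoodTower

section Finiteness

variable (F : Type u) [Field F] (k : ℕ) {X : Type u} {Z : Type v} [TopologicalSpace X]
  [TopologicalSpace Z]

theorem finite_pullback_index {W : CoverTower.{u} Z} (hW : W.IsOpenTower) {f : X → Z}
    (hf : WellBehaved f) {T : Set Z} (hT : IsCompact T) (hfT : ∀ x, f x ∈ T) (a : Set.Ici W.res) :
    Finite ((W.pullback f).ι a) := by
  have : Finite {i | (W.U a i ∩ T).Nonempty} :=
    (hW.locallyFinite a).finite_nonempty_inter_compact hT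
  have (i : W.ι a) : Finite (ZerothHomotopy (f ⁻¹' W.U a i)) :=
    hf _ (hW.isOpen a i) (hW.isPathConnected a i)
  refine Finite.of_surjective
    (fun p : Σ i : {i | (W.U a i ∩ T).Nonempty}, ZerothHomotopy (f ⁻¹' W.U a i) =>
      (⟨p.1, p.2⟩ : (W.pullback f).ι a)) ?_
  rintro ⟨i, c⟩
  induction c using Quotient.inductionOn with
  | h x => exact ⟨⟨⟨i, f x, x.2, hfT x⟩, Quotient.mk _ x⟩, rfl⟩

theorem pointwiseFinite_mapperHomology (W : CoverTower.{u} Z) (hres : 0 < W.res)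
    (hW : W.IsOpenTower) {f : X → Z} (hf : WellBehaved f) {T : Set Z} (hT : IsCompact T)
    (hfT : ∀ x, f x ∈ T) : PointwiseFinite (mapperHomology F k W hres f) := fun a => by
  have := finite_pullback_index hW hf hT hfT (expIci hres a)
  exact finite_nerveHomology F k ((W.pullback f).U (expIci hres a))

end Finiteness

/-! ### Piecewise linear functions -/

theorem finite_zerothHomotopy_of_iUnion {A ι : Type*} [TopologicalSpace A] [Finite ι]
    {S : ι → Set A} (hcover : ⋃ i, S i = Set.univ)
    (hjoined : ∀ i, ∀ x ∈ S i, ∀ y ∈ S i, Joined x y) : Finite (ZerothHomotopy A) := by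
  choose i hi using fun x => Set.mem_iUnion.1 (Set.eq_univ_iff_forall.1 hcover x)
  refine Finite.of_injective (fun q => i (Quotient.out q))
    fun q q' (hqq' : i q.out = i q'.out) => Quotient.out_equiv_out.1 ?_
  exact hjoined _ _ (hi _) _ (hqq' ▸ hi _)

section PL

variable {E : Type u} [NormedAddCommGroup E] [NormedSpace ℝ E] {K : Geometry.SimplicialComplex ℝ E}
  {f : K.space → ℝ}

theorem isCompact_space (hK : K.faces.Finite) : IsCompact K.space :=
  hK.isCompact_biUnion fun σ _ => σ.finite_toSet.isCompact_convexHull ℝ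

theorem IsPL.exists_finite_range_subset_convexHull (hf : IsPL K f) (hK : K.faces.Finite) :
    ∃ S : Set ℝ, S.Finite ∧ S ⊆ Set.range f ∧ Set.range f ⊆ convexHull ℝ S := by
  obtain ⟨φ, hφ⟩ := hf
  refine ⟨φ '' K.vertices, (hK.preimage Finset.singleton_injective.injOn).image φ, ?_, ?_⟩
  · rintro _ ⟨v, hv, rfl⟩
    refine ⟨⟨v, K.vertices_subset_space hv⟩, ?_⟩
    simpa using hφ {v} hv (fun _ => 1) (by simp) (by simp) ⟨v, _⟩ (by simp)
  · rintro _ ⟨y, rfl⟩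
    obtain ⟨σ, hσ, hy⟩ := Geometry.SimplicialComplex.mem_space_iff.1 y.2
    obtain ⟨w, hw, hw1, hwy⟩ := Finset.mem_convexHull'.1 hy
    rw [hφ σ hσ w hw hw1 y hwy.symm]
    refine (convex_convexHull ℝ _).sum_mem hw hw1 fun v hv => subset_convexHull ℝ _ ⟨v, ?_, rfl⟩
    exact K.down_closed hσ (by simpa using hv) (Finset.singleton_nonempty v)

theorem IsPL.exists_isCompact (hf : IsPL K f) (hK : K.faces.Finite) {Z : Set ℝ}
    (hZ : Z.OrdConnected) (hfZ : ∀ y, f y ∈ Z) :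
    ∃ T : Set Z, IsCompact T ∧ ∀ y, Set.codRestrict f Z hfZ y ∈ T := by
  obtain ⟨S, hS, hSf, hfS⟩ := hf.exists_finite_range_subset_convexHull hK
  have hSZ : convexHull ℝ S ⊆ Z :=
    convexHull_min (hSf.trans (Set.range_subset_iff.2 hfZ)) hZ.convex
  refine ⟨Subtype.val ⁻¹' convexHull ℝ S, ?_, fun y => hfS ⟨y, rfl⟩⟩
  rw [Topology.IsInducing.subtypeVal.isCompact_preimage_iff (by rwa [Subtype.range_val])]
  exact hS.isCompact_convexHull ℝ

theorem IsPL.apply_eq_of_combo (hf : IsPL K f) {σ : Finset E} (hσ : σ ∈ K.faces)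
    {y y' z : K.space} (hy : (y : E) ∈ convexHull ℝ (σ : Set E))
    (hy' : (y' : E) ∈ convexHull ℝ (σ : Set E)) {s t : ℝ} (hs : 0 ≤ s) (ht : 0 ≤ t)
    (hst : s + t = 1) (hz : s • (y : E) + t • (y' : E) = z) : f z = s * f y + t * f y' := by
  obtain ⟨φ, hφ⟩ := hf
  obtain ⟨w, hw, hw1, hwy⟩ := Finset.mem_convexHull'.1 hy
  obtain ⟨w', hw', hw1', hwy'⟩ := Finset.mem_convexHull'.1 hy'
  have hsum : ∑ v ∈ σ, (s * w v + t * w' v) = 1 := by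
    rw [Finset.sum_add_distrib, ← Finset.mul_sum, ← Finset.mul_sum, hw1, hw1', mul_one, mul_one,
      hst]
  have hcombo : (z : E) = ∑ v ∈ σ, (s * w v + t * w' v) • v := by
    simp only [add_smul, mul_smul, Finset.sum_add_distrib, ← Finset.smul_sum, hwy, hwy', hz]
  rw [hφ σ hσ w hw hw1 y hwy.symm, hφ σ hσ w' hw' hw1' y' hwy'.symm,
    hφ σ hσ _ (fun v hv => add_nonneg (mul_nonneg hs (hw v hv)) (mul_nonneg ht (hw' v hv)))
      hsum z hcombo]
  simp only [add_mul, mul_assoc, Finset.sum_add_distrib, Finset.mul_sum]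

theorem IsPL.convex_convexHull_inter_preimage (hf : IsPL K f) {σ : Finset E} (hσ : σ ∈ K.faces)
    {C : Set ℝ} (hC : Convex ℝ C) :
    Convex ℝ (convexHull ℝ (σ : Set E) ∩ Subtype.val '' (f ⁻¹' C)) := by
  rintro _ ⟨hyσ, y, hy, rfl⟩ _ ⟨hyσ', y', hy', rfl⟩ s t hs ht hst
  have hmem := convex_convexHull ℝ _ hyσ hyσ' hs ht hst
  refine ⟨hmem, ⟨_, Geometry.SimplicialComplex.mem_space_iff.2 ⟨σ, hσ, hmem⟩⟩, ?_, rfl⟩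
  rw [Set.mem_preimage, hf.apply_eq_of_combo hσ hyσ hyσ' hs ht hst rfl]
  exact hC hy hy' hs ht hst

theorem IsPL.joinedIn_preimage (hf : IsPL K f) {σ : Finset E} (hσ : σ ∈ K.faces) {C : Set ℝ}
    (hC : Convex ℝ C) {y y' : K.space} (hyσ : (y : E) ∈ convexHull ℝ (σ : Set E))
    (hyσ' : (y' : E) ∈ convexHull ℝ (σ : Set E)) (hy : f y ∈ C) (hy' : f y' ∈ C) :
    JoinedIn (f ⁻¹' C) y y' := by
  rw [← Topology.IsInducing.subtypeVal.joinedIn_image hy hy']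
  exact JoinedIn.of_segment_subset
    (((hf.convex_convexHull_inter_preimage hσ hC).segment_subset ⟨hyσ, y, hy, rfl⟩
      ⟨hyσ', y', hy', rfl⟩).trans Set.inter_subset_right)

theorem IsPL.finite_zerothHomotopy_preimage (hf : IsPL K f) (hK : K.faces.Finite) {C : Set ℝ}
    (hC : Convex ℝ C) : Finite (ZerothHomotopy (f ⁻¹' C)) := by
  have := hK.to_subtype
  refine finite_zerothHomotopy_of_iUnion (ι := K.faces)
    (S := fun σ => {y | ((y : K.space) : E) ∈ convexHull ℝ ((σ : Finset E) : Set E)}) ?_ ?_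
  · refine Set.eq_univ_of_forall fun y => Set.mem_iUnion.2 ?_
    obtain ⟨σ, hσ, hy⟩ := Geometry.SimplicialComplex.mem_space_iff.1 y.1.2
    exact ⟨⟨σ, hσ⟩, hy⟩
  · exact fun σ y hyσ y' hyσ' => (hf.joinedIn_preimage σ.2 hC hyσ hyσ' y.2 y'.2).joined_subtype

theorem IsPL.wellBehaved (hf : IsPL K f) (hK : K.faces.Finite) {Z : Set ℝ}
    (hfZ : ∀ y, f y ∈ Z) : WellBehaved (Set.codRestrict f Z hfZ) := by
  intro V _ hV
  have hconv : Convex ℝ (Subtype.val '' V : Set ℝ) :=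
    (hV.image continuous_subtype_val).isConnected.isPreconnected.ordConnected.convex
  have hpre : Set.codRestrict f Z hfZ ⁻¹' V = f ⁻¹' (Subtype.val '' V) := by
    conv_lhs => rw [← Set.preimage_image_eq V Subtype.val_injective]
    rfl
  rw [hpre]
  exact hf.finite_zerothHomotopy_preimage hK hconv

end PL

end MultiMapper

end

theorem mainTheorem10_general
    (F : Type u) [Field F] (k : ℕ) {X Y : Type u} [TopologicalSpace X] [TopologicalSpace Y]
    {Z : Type v} [MetricSpace Z] [PreconnectedSpace Z]
    (W : MultiMapper.CoverTower.{u} Z) (c s δ : ℝ) (hW : W.IsOpenTower) (hgood : W.IsGood c s)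
    (f : Y → Z) (hf : MultiMapper.WellBehaved f) (T : Set Z) (hT : IsCompact T)
    (hfT : ∀ y, f y ∈ T)
    (g : X → Z) (hg : MultiMapper.WellBehaved g) (T' : Set Z) (hT' : IsCompact T')
    (hgT' : ∀ x, g x ∈ T')
    (h : X ≃ₜ Y) (hfg : ∀ x, dist (f (h x)) (g x) ≤ δ) :
    MultiMapper.PointwiseFinite (MultiMapper.mapperHomology F k W hgood.res_pos f) ∧
      MultiMapper.PointwiseFinite (MultiMapper.mapperHomology F k W hgood.res_pos g) ∧
      MultiMapper.bottleneckDist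
          (MultiMapper.diagram (MultiMapper.mapperHomology F k W hgood.res_pos f))
          (MultiMapper.diagram (MultiMapper.mapperHomology F k W hgood.res_pos g)) ≤
        ENNReal.ofReal (Real.log (2 * c * max s δ + c) + max 0 (Real.log (1 / s))) := by
  have hfin := MultiMapper.pointwiseFinite_mapperHomology F k W hgood.res_pos hW hf hT hfT
  have hfin' := MultiMapper.pointwiseFinite_mapperHomology F k W hgood.res_pos hW hg hT' hgT'
  have hδ (x : X) : dist (f (h x)) (g x) ≤ max s δ := (hfg x).trans (le_max_right _ _)
  refine ⟨hfin, hfin', MultiMapper.bottleneckDist_homology_MM_le F k (W.reindexLog hgood.res_pos) h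
    (fun a b hab i => ?_) (fun a b hab i => ?_) hfin hfin'⟩ <;>
  obtain ⟨j, hj⟩ := hgood.exists_cthickening_subset_reindexLog hW (le_max_left s δ) hab i
  · have hδ' (x : X) : dist (g x) (f (h x)) ≤ max s δ := dist_comm (g x) _ ▸ hδ x
    exact ⟨j, fun x hx => hj (Metric.mem_cthickening_of_dist_le _ _ _ _ hx (hδ' x))⟩
  · exact ⟨j, fun x hx => hj (Metric.mem_cthickening_of_dist_le _ _ _ _ hx (hδ x))⟩

theorem mainTheorem10
    (F : Type u) [Field F]
    {E : Type u} [NormedAddCommGroup E] [NormedSpace ℝ E]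
    (K : Geometry.SimplicialComplex ℝ E) (hK : K.faces.Finite)
    {X : Type u} [TopologicalSpace X]
    (Z : Set ℝ) (hZ : Z.OrdConnected)
    (W : MultiMapper.CoverTower.{u} Z) (c s δ : ℝ)
    (hW : W.IsOpenTower) (hgood : W.IsGood c s)
    (f : K.space → ℝ) (hfZ : ∀ y, f y ∈ Z) (hf : MultiMapper.IsPL K f)
    (g : X → ℝ) (hgZ : ∀ x, g x ∈ Z) (hg : Continuous g)
    (hgw : MultiMapper.WellBehaved (Set.codRestrict g Z hgZ))
    (happrox : MultiMapper.DeltaApproximates K f g δ) (k : ℕ) :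
    MultiMapper.PointwiseFinite
        (MultiMapper.mapperHomology F k W hgood.res_pos (Set.codRestrict f Z hfZ)) ∧
      MultiMapper.PointwiseFinite
        (MultiMapper.mapperHomology F k W hgood.res_pos (Set.codRestrict g Z hgZ)) ∧
      MultiMapper.bottleneckDist
          (MultiMapper.diagram
            (MultiMapper.mapperHomology F k W hgood.res_pos (Set.codRestrict f Z hfZ)))
          (MultiMapper.diagram
            (MultiMapper.mapperHomology F k W hgood.res_pos (Set.codRestrict g Z hgZ))) ≤
        ENNReal.ofReal (Real.log (2 * c * max s δ + c) + max 0 (Real.log (1 / s))) := by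
  obtain ⟨h, hh⟩ := happrox
  have hfg (x : X) : |f (h x) - g x| ≤ δ := by simpa only [h.symm_apply_apply] using hh (h x)
  obtain ⟨T, hT, hfT⟩ := hf.exists_isCompact hK hZ hfZ
  have : PreconnectedSpace Z := Subtype.preconnectedSpace hZ.isPreconnected
  have : CompactSpace K.space := isCompact_iff_compactSpace.1 (MultiMapper.isCompact_space hK)
  have : CompactSpace X := h.symm.compactSpace
  exact mainTheorem10_general F k W c s δ hW hgood _ (hf.wellBehaved hK hfZ) T hT hfT _ hgw _
    (isCompact_range (hg.codRestrict hgZ)) Set.mem_range_self h hfg
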